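/- Let $n\ge 2$, $s\in(0,1)$, $p\in(1,\infty)$. Let $S\subset\mathbb R^n$ be either an open set (with $d=n$ and $\mu$ the Lebesgue measure on $S$) or a sphere $\partial B(x_0,r)$ (with $d=n-1$ and $\mu$ the Hausdorff measure $\mathcal H^{n-1}$ on $S$). The space $W^{s,p}(S;\mathbb R^n)$ consists of all $u\in L^p(S,\mu;\mathbb R^n)$ with $$[u]_{W^{s,p}(S)}^p:=\int_S\int_S\frac{|u(x)-u(y)|^p}{|x-y|^{d+sp}}\,d\mu(y)\,d\mu(x)<\infty,$$ with norm $\|u\|_{W^{s,p}(S)}=\big(\|u\|_{L^p(S)}^p+[u]_{W^{s,p}(S)}^p\big)^{1/p}$, and $\rightharpoonup$ denotes weak convergence in this space. The precise representative of $f$ is $$f^*(x):=\lim_{\rho\to0^+}\frac1{|B(x,\rho)|}\int_{B(x,\rho)}f(y)\,dy$$ where this limit exists, and $f^*(x):=0$ otherwise. **Lemma.** Let $\Omega\subset\mathbb R^n$ be a bounded domain and let $f_k\rightharpoonup f$ in $W^{s,p}(\Omega;\mathbb R^n)$. Let $x_0\in\Omega$ and $r_{x_0}:=\operatorname{dist}(x_0,\partial\Omega)$.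 Then there is a set $N_{x_0}\subset\mathbb R$ of Lebesgue measure zero such that for every $r\in(0,r_{x_0})\setminus N_{x_0}$ there is a subsequence $(f_{k_j})_j$ (depending on $r$ in general) with $$f_{k_j}^*\rightharpoonup f^*\quad\text{in } W^{s,p}(\partial B(x_0,r);\mathbb R^n)$$ (in particular, $f^*$ and all the $f_{k_j}^*$ belong to this space), and, if $sp>n-1$, for the same subsequence, $f_{k_j}^*\to f^*$ uniformly on $\partial B(x_0,r)$. -/

import Mathlib

open MeasureTheory Filter Topology Set Metric
open scoped ENNReal NNReal

/-- Euclidean space `ℝⁿ` with the Euclidean norm. -/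
abbrev RSpace (n : ℕ) : Type := EuclideanSpace ℝ (Fin n)

noncomputable section

/-! ### Fractional Sobolev spaces

The space `W^{s,p}` is defined for functions on a set `S ⊆ ℝⁿ` of dimension `d`
carrying a measure `μ` (a measure on `ℝⁿ` concentrated on `S`). It is used for
* an open set `Ω ⊆ ℝⁿ`, with Lebesgue measure on `Ω` and `d = n`;
* a sphere `∂B(a, r)`, with the Hausdorff measure `ℋ^{n-1}` on the sphere and `d = n - 1`. -/

/-- `∬ |u(x) - u(y)|^p / |x - y|^{d + sp} dμ(y) dμ(x)`, the `p`-th power of the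
Gagliardo seminorm. -/
def gagliardoPow {n : ℕ} (d s p : ℝ) (μ : Measure (RSpace n)) (u : RSpace n → RSpace n) : ℝ≥0∞ :=
  ∫⁻ x, ∫⁻ y, ‖u x - u y‖ₑ ^ p / ‖x - y‖ₑ ^ (d + s * p) ∂μ ∂μ

/-- The `W^{s,p}` norm `(‖u‖_{L^p}^p + [u]_{W^{s,p}}^p)^{1/p}`. -/
def fracSobolevNorm {n : ℕ} (d s p : ℝ) (μ : Measure (RSpace n)) (u : RSpace n → RSpace n) : ℝ :=
  ((∫⁻ x, ‖u x‖ₑ ^ p ∂μ + gagliardoPow d s p μ u) ^ (1 / p)).toReal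

theorem gagliardo_aemeasurable {n : ℕ} (d s p : ℝ) (μ : Measure (RSpace n)) [SFinite μ]
    {u : RSpace n → RSpace n} (hu : AEStronglyMeasurable u μ) :
    AEMeasurable (fun z : RSpace n × RSpace n =>
      ‖u z.1 - u z.2‖ₑ ^ p / ‖z.1 - z.2‖ₑ ^ (d + s * p)) (μ.prod μ) := by
  have h1 : AEStronglyMeasurable (fun z : RSpace n × RSpace n => u z.1 - u z.2) (μ.prod μ) :=
    (hu.comp_fst).sub (hu.comp_snd)
  refine (h1.enorm.pow_const p).div (Measurable.aemeasurable ?_)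
  fun_prop

theorem gagliardoPow_add_lt_top {n : ℕ} (d s : ℝ) {p : ℝ} (hp : 1 ≤ p) (μ : Measure (RSpace n))
    [SFinite μ] {u v : RSpace n → RSpace n} (hu : AEStronglyMeasurable u μ)
    (hv : AEStronglyMeasurable v μ) (hgu : gagliardoPow d s p μ u < ∞)
    (hgv : gagliardoPow d s p μ v < ∞) : gagliardoPow d s p μ (u + v) < ∞ := by
  have hmu := gagliardo_aemeasurable d s p μ hu
  have hmv := gagliardo_aemeasurable d s p μ hv
  have hmw := gagliardo_aemeasurable d s p μ (hu.add hv)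
  unfold gagliardoPow at *
  rw [← lintegral_prod _ hmu] at hgu
  rw [← lintegral_prod _ hmv] at hgv
  rw [← lintegral_prod _ hmw]
  refine lt_of_le_of_lt (b := ∫⁻ z : RSpace n × RSpace n, (2 : ℝ≥0∞) ^ (p - 1) *
    (‖u z.1 - u z.2‖ₑ ^ p / ‖z.1 - z.2‖ₑ ^ (d + s * p) +
      ‖v z.1 - v z.2‖ₑ ^ p / ‖z.1 - z.2‖ₑ ^ (d + s * p)) ∂(μ.prod μ)) ?_ ?_
  · refine lintegral_mono fun z => ?_
    simp only [Pi.add_apply]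
    rw [← ENNReal.add_div, ← mul_div_assoc]
    refine ENNReal.div_le_div_right ?_ _
    refine le_trans ?_ (ENNReal.rpow_add_le_mul_rpow_add_rpow _ _ hp)
    refine ENNReal.rpow_le_rpow ?_ (by linarith)
    rw [add_sub_add_comm]
    exact enorm_add_le _ _
  · have h2 : (2 : ℝ≥0∞) ^ (p - 1) < ∞ :=
      ENNReal.rpow_lt_top_of_nonneg (by linarith) (by norm_num)
    rw [lintegral_const_mul' _ _ h2.ne, lintegral_add_left' hmu]
    exact ENNReal.mul_lt_top h2 (ENNReal.add_lt_top.2 ⟨hgu, hgv⟩)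

/-- The fractional Sobolev space `W^{s,p}(S; ℝⁿ)`: the functions of `L^p(S; ℝⁿ)` whose Gagliardo
seminorm is finite. Its elements are functions, and two of them that agree `μ`-almost everywhere
have the same class (their difference has norm zero). -/
def fracSobolev {n : ℕ} (d s p : ℝ) (hp : 1 ≤ p) (μ : Measure (RSpace n)) [SFinite μ] :
    Submodule ℝ (RSpace n → RSpace n) where
  carrier := {u | MemLp u (ENNReal.ofReal p) μ ∧ gagliardoPow d s p μ u < ∞}
  zero_mem' := by
    refine ⟨MemLp.zero, ?_⟩
    simp [gagliardoPow, ENNReal.zero_rpow_of_pos (lt_of_lt_of_le one_pos hp)]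
  add_mem' := fun {u v} hu hv => ⟨hu.1.add hv.1,
    gagliardoPow_add_lt_top d s hp μ hu.1.1 hv.1.1 hu.2 hv.2⟩
  smul_mem' := fun c u hu => by
    refine ⟨hu.1.const_smul c, ?_⟩
    have hp0 : 0 ≤ p := by linarith
    have h : gagliardoPow d s p μ (c • u) = ‖c‖ₑ ^ p * gagliardoPow d s p μ u := by
      have hc : ‖c‖ₑ ^ p ≠ ∞ := ENNReal.rpow_ne_top_of_nonneg hp0 (by simp)
      unfold gagliardoPow
      rw [← lintegral_const_mul' _ _ hc]
      refine lintegral_congr fun x => ?_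
      rw [← lintegral_const_mul' _ _ hc]
      refine lintegral_congr fun y => ?_
      simp only [Pi.smul_apply]
      rw [← smul_sub, enorm_smul, ENNReal.mul_rpow_of_nonneg _ _ hp0, mul_div_assoc]
    rw [h]
    exact ENNReal.mul_lt_top (ENNReal.rpow_lt_top_of_nonneg hp0 (by simp)) hu.2

/-- Weak convergence `u_k ⇀ u` in `W^{s,p}`: all the functions belong to the space, and
`L u_k → L u` for every bounded linear functional `L` on it. -/
def WeaklyConverges {n : ℕ} (d s p : ℝ) (hp : 1 ≤ p) (μ : Measure (RSpace n)) [SFinite μ]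
    (u : ℕ → RSpace n → RSpace n) (v : RSpace n → RSpace n) : Prop :=
  ∃ (hu : ∀ k, u k ∈ fracSobolev d s p hp μ) (hv : v ∈ fracSobolev d s p hp μ),
    ∀ L : fracSobolev d s p hp μ →ₗ[ℝ] ℝ,
      (∃ C : ℝ, ∀ w : fracSobolev d s p hp μ, |L w| ≤ C * fracSobolevNorm d s p μ w.1) →
      Tendsto (fun k => L ⟨u k, hu k⟩) atTop (𝓝 (L ⟨v, hv⟩))

/-! ### Surface measure on spheres -/

/-- The Hausdorff measure `ℋ^{n-1}` on the sphere `∂B(a, r)` of `ℝⁿ`. -/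
def sphereMeasure {n : ℕ} (a : RSpace n) (r : ℝ) : Measure (RSpace n) :=
  (μH[(n : ℝ) - 1] : Measure (RSpace n)).restrict (sphere a r)

/-- The map of `ℝ^{n-1}` onto the face `{x i = c}` of a cube, followed by the radial projection to
the sphere `∂B(a, r)`. -/
def faceMap {n : ℕ} (a : RSpace n) (r : ℝ) (i : Fin n) (c : ℝ) (y : {j : Fin n // j ≠ i} → ℝ) :
    RSpace n :=
  let z : RSpace n := WithLp.toLp 2 (fun j => if h : j ≠ i then y ⟨j, h⟩ else c)
  a + (r / ‖z‖) • z

theorem faceMap_contDiff {n : ℕ} (a : RSpace n) (r : ℝ) (i : Fin n) (c : ℝ) (hc : c ≠ 0) :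
    ContDiff ℝ 1 (faceMap a r i c) := by
  have hz : ContDiff ℝ 1 (fun y : {j : Fin n // j ≠ i} → ℝ =>
      (WithLp.toLp 2 (fun j => if h : j ≠ i then y ⟨j, h⟩ else c) : RSpace n)) := by
    rw [contDiff_euclidean]
    intro j
    by_cases h : j ≠ i
    · simp only [h, ne_eq, not_false_eq_true, dite_true]
      fun_prop
    · simp only [h, dite_false]
      fun_prop
  have h0 : ∀ y : {j : Fin n // j ≠ i} → ℝ,
      (WithLp.toLp 2 (fun j => if h : j ≠ i then y ⟨j, h⟩ else c) : RSpace n) ≠ 0 := by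
    intro y h
    apply hc
    have := congrArg (fun w : RSpace n => w i) h
    simpa using this
  unfold faceMap
  exact contDiff_const.add
    ((contDiff_const.div (hz.norm ℝ h0) fun y => norm_ne_zero_iff.2 (h0 y)).smul hz)

theorem hausdorff_sphere_lt_top {n : ℕ} (hn : n ≠ 0) (a : RSpace n) (r : ℝ) :
    (μH[(n : ℝ) - 1] : Measure (RSpace n)) (sphere a r) < ∞ := by
  have hcov : sphere a r ⊆ {a} ∪ ⋃ i : Fin n, ⋃ b : Bool,
      faceMap a r i (if b then 1 else -1) '' closedBall 0 1 := by
    intro x hx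
    have hxr : ‖x - a‖ = r := by simpa [dist_eq_norm] using hx
    by_cases hxa : x = a
    · exact Or.inl hxa
    right
    have : Nonempty (Fin n) := ⟨⟨0, Nat.pos_of_ne_zero hn⟩⟩
    obtain ⟨i, hi⟩ := Finite.exists_max (fun j => |(x - a) j|)
    have hr0 : 0 < ‖x - a‖ := norm_pos_iff.2 (sub_ne_zero.2 hxa)
    have hm : 0 < |(x - a) i| := by
      rcases (abs_nonneg ((x - a) i)).lt_or_eq with h | h
      · exact h
      · exfalso
        apply hxa
        rw [← sub_eq_zero]
        ext j
        have := hi j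
        rw [← h] at this
        simpa using abs_nonpos_iff.1 this
    set m := |(x - a) i| with hmdef
    refine mem_iUnion.2 ⟨i, mem_iUnion.2 ⟨decide (0 < (x - a) i),
      fun j => (x - a) j.1 / m, ?_, ?_⟩⟩
    · rw [mem_closedBall_zero_iff, pi_norm_le_iff_of_nonneg zero_le_one]
      intro j
      rw [Real.norm_eq_abs, abs_div, abs_of_pos hm]
      exact div_le_one_of_le₀ (hi j.1) hm.le
    · have hz : (WithLp.toLp 2 (fun j => if _h : j ≠ i then (x - a) j / m else
          if decide (0 < (x - a) i) then (1 : ℝ) else -1) : RSpace n) = m⁻¹ • (x - a) := by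
        ext j
        by_cases h : j = i
        · subst h
          simp only [ne_eq, not_true_eq_false, dite_false, decide_eq_true_eq]
          rw [PiLp.smul_apply, smul_eq_mul]
          split_ifs with h2
          · rw [hmdef, abs_of_pos h2, inv_mul_cancel₀ h2.ne']
          · have h3 : (x - a) j < 0 := lt_of_le_of_ne (not_lt.1 h2) (abs_pos.1 hm)
            rw [hmdef, abs_of_neg h3, inv_neg, neg_mul, inv_mul_cancel₀ h3.ne]
        · simp [h, div_eq_inv_mul]
      unfold faceMap
      simp only
      rw [hz, norm_smul, norm_inv, Real.norm_eq_abs, abs_of_pos hm, hxr, smul_smul]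
      rw [hxr] at hr0
      have : r / (m⁻¹ * r) * m⁻¹ = 1 := by
        field_simp
      rw [this, one_smul, add_sub_cancel]
  have hn1 : (0 : ℝ) ≤ (n : ℝ) - 1 := by
    have : (1 : ℝ) ≤ n := by exact_mod_cast Nat.one_le_iff_ne_zero.2 hn
    linarith
  refine lt_of_le_of_lt (measure_mono hcov) ?_
  refine lt_of_le_of_lt (measure_union_le _ _) (ENNReal.add_lt_top.2 ⟨?_, ?_⟩)
  · refine lt_of_le_of_lt (Measure.hausdorffMeasure_mono hn1 _) ?_
    rw [Measure.hausdorffMeasure_zero_singleton]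
    exact ENNReal.one_lt_top
  · refine lt_of_le_of_lt (measure_iUnion_le _) ?_
    rw [tsum_fintype]
    refine ENNReal.sum_lt_top.2 fun i _ => ?_
    refine lt_of_le_of_lt (measure_iUnion_le _) ?_
    rw [tsum_fintype]
    refine ENNReal.sum_lt_top.2 fun b _ => ?_
    obtain ⟨K, hK⟩ := (faceMap_contDiff a r i (if b then 1 else -1)
      (by cases b <;> simp)).contDiffOn.exists_lipschitzOnWith one_ne_zero
      (convex_closedBall 0 1) (isCompact_closedBall (0 : {j : Fin n // j ≠ i} → ℝ) 1)
    refine lt_of_le_of_lt (hK.hausdorffMeasure_image_le hn1) ?_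
    have hcard : ((Fintype.card {j : Fin n // j ≠ i} : ℕ) : ℝ) = (n : ℝ) - 1 := by
      rw [Fintype.card_subtype_compl, Fintype.card_fin, Fintype.card_subtype_eq,
        Nat.cast_sub (Nat.one_le_iff_ne_zero.2 hn), Nat.cast_one]
    rw [← hcard, hausdorffMeasure_pi_real]
    exact ENNReal.mul_lt_top (ENNReal.rpow_lt_top_of_nonneg (by positivity) (by simp))
      (isCompact_closedBall _ _).measure_lt_top

instance sphereMeasure_sFinite {n : ℕ} (a : RSpace n) (r : ℝ) : SFinite (sphereMeasure a r) := by
  by_cases hn : n = 0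
  · subst hn
    have h : sphereMeasure a r = (sphereMeasure a r univ) • Measure.dirac a := by
      ext s _
      rcases Subsingleton.eq_empty_or_singleton (subsingleton_of_subsingleton (s := s)) with h | ⟨x, h⟩
      · simp [h]
      · have : s = univ := by
          rw [h]; exact Set.eq_univ_of_forall fun y => Subsingleton.elim _ _
        simp [this]
    rw [h]
    infer_instance
  · have : IsFiniteMeasure (sphereMeasure a r) := by
      refine ⟨?_⟩
      rw [sphereMeasure, Measure.restrict_apply_univ]
      exact hausdorff_sphere_lt_top hn a r
    infer_instance

/-! ### The precise representative -/

open Classical in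
/-- The precise representative `f*`: the limit of the averages of `f` over the balls `B(x, r)` as
`r → 0⁺` where this limit exists, and `0` elsewhere. -/
def preciseRep {n : ℕ} (f : RSpace n → RSpace n) (x : RSpace n) : RSpace n :=
  if h : ∃ c, Tendsto (fun r : ℝ => ⨍ y in ball x r, f y) (𝓝[>] 0) (𝓝 c) then h.choose else 0

end

/-! The argument slices by polar coordinates around x₀. Write Γ_u(x) for the inner Gagliardo
integral ∫_Ω |u(x) - u(z)|^p / |x - z|^{n+sp} dz. A weakly convergent sequence is bounded
(Banach–Steinhaus), so the integrals of |f_k|^p + Γ_{f_k} over Ω are bounded. Integrating over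
spheres and applying Fatou, for almost every r the integrals over ∂B(x₀, r) have finite liminf,
hence are bounded along a subsequence that depends on r.

The sphere energy is controlled by that integral: [u]^p on ∂B(x₀, r) is at most K ∫ Γ_u over ∂B(x₀,
r) (`exists_gagliardoPow_sphere_le`). For x, y on the sphere, compare u(x) and u(y) with u(z) for z
in a ball of radius |x - y|/4 inside B(x₀, r), average over z, and integrate out the point that does
not occur in the difference. So the subsequence is bounded in W^{s,p} of the sphere.

The limit is identified by strong L^p convergence on smaller balls
(`tendsto_lintegral_sub_of_average`). Averages over a fixed ball are bounded functionals, so they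
converge, and the fractional Poincaré inequality says that averages at scale ρ are uniformly close
to the functions. A subsequence converges almost everywhere, hence almost everywhere on almost every
sphere, where the precise representatives also agree with the functions. Boundedness and almost
everywhere convergence give weak convergence (`weaklyConverges_of_ae_tendsto`): W^{s,p} embeds in a
product of L^p spaces, functionals extend by Hahn–Banach, and a functional on L^q, 1 < q < ∞, is
uniformly small on unit-ball functions supported in small sets, so Egorov applies. No description of
the dual is used.

If sp > n - 1, comparing averages over B(x, ρ) and B(x, τ) with the values on the spherical cap
around x gives a Campanato-type rate ρ^{(sp-(n-1))/p} at every x of the sphere, uniform along the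
subsequence (`exists_average_sub_preciseRep_le`). With L^p convergence this yields uniform
convergence.

Polar coordinates produce the cone measure, while the statement uses ℋ^{n-1}. Only the bound ℋ^{n-1}
≤ C · cone measure is needed (`exists_sphereMeasure_le_smul`); it follows from two-sided ball
estimates and rotational symmetry. -/

noncomputable section

/-! ### Polar coordinates and the cone measure on spheres -/

/-- The cone measure on `∂B(a, r)`, scaled to have the mass of the unit sphere: the image of the
spherical part of Lebesgue measure under `θ ↦ a + r θ`. -/
def radialMeasure {n : ℕ} (a : RSpace n) (r : ℝ) : Measure (RSpace n) :=
  Measure.map (fun θ : sphere (0 : RSpace n) 1 => a + r • (θ : RSpace n))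
    (volume : Measure (RSpace n)).toSphere

theorem measurable_radial {n : ℕ} (a : RSpace n) (r : ℝ) :
    Measurable (fun θ : sphere (0 : RSpace n) 1 => a + r • (θ : RSpace n)) := by
  fun_prop

instance {n : ℕ} (a : RSpace n) (r : ℝ) : IsFiniteMeasure (radialMeasure a r) := by
  unfold radialMeasure; infer_instance

theorem lintegral_radialMeasure {n : ℕ} (a : RSpace n) (r : ℝ) {F : RSpace n → ℝ≥0∞}
    (hF : Measurable F) : ∫⁻ x, F x ∂(radialMeasure a r) =
      ∫⁻ θ : sphere (0 : RSpace n) 1, F (a + r • (θ : RSpace n))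
        ∂(volume : Measure (RSpace n)).toSphere :=
  lintegral_map hF (measurable_radial a r)

theorem measurable_lintegral_radialMeasure {n : ℕ} (a : RSpace n) {F : RSpace n → ℝ≥0∞}
    (hF : Measurable F) : Measurable fun r : ℝ => ∫⁻ x, F x ∂(radialMeasure a r) := by
  simp_rw [lintegral_radialMeasure a _ hF]
  refine Measurable.lintegral_prod_right' (f := fun q : ℝ × sphere (0 : RSpace n) 1 =>
    F (a + q.1 • (q.2 : RSpace n))) ?_
  refine hF.comp ?_
  fun_prop

/-- The weight r^{n-1} stays outside `radialMeasure`, whose total mass does not depend on r. -/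
theorem lintegral_polar {n : ℕ} (hn : n ≠ 0) (a : RSpace n) {F : RSpace n → ℝ≥0∞}
    (hF : Measurable F) : ∫⁻ x, F x =
      ∫⁻ r in Ioi (0 : ℝ), ENNReal.ofReal (r ^ (n - 1)) * ∫⁻ x, F x ∂(radialMeasure a r) := by
  have : Nonempty (Fin n) := ⟨⟨0, Nat.pos_of_ne_zero hn⟩⟩
  have hmp := (volume : Measure (RSpace n)).measurePreserving_homeomorphUnitSphereProd
  have hF' : Measurable fun q : sphere (0 : RSpace n) 1 × Ioi (0 : ℝ) =>
      F (a + (q.2 : ℝ) • (q.1 : RSpace n)) := hF.comp (by fun_prop)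
  calc ∫⁻ x, F x = ∫⁻ x, F (a + x) := (lintegral_add_left_eq_self _ a).symm
    _ = ∫⁻ x in ({0}ᶜ : Set (RSpace n)), F (a + x) := by
        rw [restrict_compl_singleton]
    _ = ∫⁻ x : ({0}ᶜ : Set (RSpace n)), F (a + x)
          ∂(Measure.comap (↑) (volume : Measure (RSpace n))) := by
        rw [lintegral_subtype_comap (measurableSet_singleton _).compl (fun x => F (a + x))]
    _ = ∫⁻ x : ({0}ᶜ : Set (RSpace n)), (fun q : sphere (0 : RSpace n) 1 × Ioi (0 : ℝ) =>
          F (a + (q.2 : ℝ) • (q.1 : RSpace n))) (homeomorphUnitSphereProd (RSpace n) x)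
          ∂(Measure.comap (↑) (volume : Measure (RSpace n))) := by
        refine lintegral_congr fun x => ?_
        have hx : ‖(x : RSpace n)‖ ≠ 0 := norm_ne_zero_iff.2 x.2
        simp [smul_smul, mul_inv_cancel₀ hx]
    _ = _ := by
        rw [hmp.lintegral_comp hF', lintegral_prod_symm _ hF'.aemeasurable, Measure.volumeIoiPow,
          lintegral_withDensity_eq_lintegral_mul _ (by fun_prop) hF'.lintegral_prod_left',
          ← lintegral_subtype_comap measurableSet_Ioi]
        refine lintegral_congr fun r => ?_
        simp only [Pi.mul_apply, lintegral_radialMeasure a _ hF, finrank_euclideanSpace,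
          Fintype.card_fin]

theorem norm_radial_sub {n : ℕ} (a : RSpace n) {r : ℝ} (hr : 0 ≤ r)
    (θ : sphere (0 : RSpace n) 1) : ‖a + r • (θ : RSpace n) - a‖ = r := by
  rw [add_sub_cancel_left, norm_smul, Real.norm_of_nonneg hr, norm_eq_of_mem_sphere, mul_one]

theorem radialMeasure_mem_sphere {n : ℕ} (a : RSpace n) {r : ℝ} (hr : 0 ≤ r) :
    ∀ᵐ x ∂(radialMeasure a r), x ∈ sphere a r := by
  refine (ae_map_iff (measurable_radial a r).aemeasurable isClosed_sphere.measurableSet).2 (ae_of_all _ ?_)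
  intro θ
  refine mem_sphere_iff_norm.2 ?_
  exact norm_radial_sub a hr θ

theorem radialMeasure_univ_ne_zero {n : ℕ} (hn : n ≠ 0) (a : RSpace n) (r : ℝ) :
    radialMeasure a r univ ≠ 0 := by
  have : Nonempty (Fin n) := ⟨⟨0, Nat.pos_of_ne_zero hn⟩⟩
  rw [radialMeasure, Measure.map_apply (measurable_radial a r) MeasurableSet.univ, preimage_univ]
  exact Measure.measure_univ_ne_zero.2 (volume : Measure (RSpace n)).toSphere_ne_zero

/-- A property that holds almost everywhere holds on almost every sphere. -/
theorem ae_radialMeasure {n : ℕ} (hn : n ≠ 0) (a : RSpace n) {P : RSpace n → Prop}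
    {s : Set (RSpace n)} {R : ℝ} (hs : ball a R ⊆ s) (h : ∀ᵐ x ∂(volume.restrict s), P x) :
    ∀ᵐ r ∂(volume.restrict (Ioo (0 : ℝ) R)), ∀ᵐ x ∂(radialMeasure a r), P x := by
  have h' := ae_restrict_of_ae_restrict_of_subset hs h
  rw [ae_restrict_iff' measurableSet_ball] at h'
  -- The exceptional set need not be measurable; a measurable null hull allows the polar formula for
  -- its indicator.
  set N := toMeasurable volume {x | ¬ (x ∈ ball a R → P x)} with hN
  have hN0 : volume N = 0 := by rw [hN, measure_toMeasurable]; exact h'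
  have hNm : MeasurableSet N := measurableSet_toMeasurable _ _
  have h1 := lintegral_polar hn a (F := N.indicator 1) (measurable_one.indicator hNm)
  rw [lintegral_indicator_one hNm, hN0] at h1
  have h2 := (lintegral_eq_zero_iff ((by fun_prop : Measurable fun r : ℝ =>
    ENNReal.ofReal (r ^ (n - 1))).mul (measurable_lintegral_radialMeasure a
      (measurable_one.indicator hNm)))).1 h1.symm
  have h3 := ae_restrict_of_ae_restrict_of_subset (Ioo_subset_Ioi_self : Ioo 0 R ⊆ Ioi 0) h2
  filter_upwards [h3, ae_restrict_mem measurableSet_Ioo] with r hr hrR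
  simp only [Pi.mul_apply, Pi.zero_apply, mul_eq_zero, ENNReal.ofReal_eq_zero] at hr
  rcases hr with hr | hr
  · exact absurd hr (not_le.2 (pow_pos hrR.1 _))
  · rw [lintegral_indicator_one hNm] at hr
    filter_upwards [measure_eq_zero_iff_ae_notMem.1 hr, radialMeasure_mem_sphere a hrR.1.le]
      with x hx hxs
    have : x ∉ {x | ¬ (x ∈ ball a R → P x)} := fun h => hx (subset_toMeasurable _ _ h)
    simp only [mem_ofPred_eq, not_not] at this
    exact this (sphere_subset_ball hrR.2 hxs)

/-- A bounded sequence in `L¹` of a ball is bounded along a subsequence on almost every sphere. -/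
theorem ae_liminf_radialMeasure {n : ℕ} (hn : n ≠ 0) (a : RSpace n) {R : ℝ}
    {F : ℕ → RSpace n → ℝ≥0∞} (hF : ∀ k, Measurable (F k)) {M : ℝ≥0∞} (hM : M ≠ ∞)
    (h : ∀ k, ∫⁻ x in ball a R, F k x ≤ M) :
    ∀ᵐ r ∂(volume.restrict (Ioo (0 : ℝ) R)),
      liminf (fun k => ∫⁻ x, F k x ∂(radialMeasure a r)) atTop < ∞ := by
  have hmeas : ∀ k, Measurable fun r : ℝ => ENNReal.ofReal (r ^ (n - 1)) *
      ∫⁻ x, F k x ∂(radialMeasure a r) := fun k =>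
    (by fun_prop : Measurable fun r : ℝ => ENNReal.ofReal (r ^ (n - 1))).mul
      (measurable_lintegral_radialMeasure a (hF k))
  have h1 : ∀ k, ∫⁻ r in Ioo (0 : ℝ) R, ENNReal.ofReal (r ^ (n - 1)) *
      ∫⁻ x, F k x ∂(radialMeasure a r) ≤ M := by
    intro k
    refine le_trans ?_ (h k)
    rw [← lintegral_indicator measurableSet_ball, lintegral_polar hn a
      ((hF k).indicator measurableSet_ball)]
    refine le_trans ?_ (lintegral_mono_set (Ioo_subset_Ioi_self : Ioo 0 R ⊆ Ioi 0))
    refine setLIntegral_mono' measurableSet_Ioo fun r hr => ?_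
    refine mul_le_mul_right (lintegral_mono_ae ?_) _
    filter_upwards [radialMeasure_mem_sphere a hr.1.le] with x hx
    rw [indicator_of_mem (sphere_subset_ball hr.2 hx)]
  have h2 : ∫⁻ r in Ioo (0 : ℝ) R, liminf (fun k => ENNReal.ofReal (r ^ (n - 1)) *
      ∫⁻ x, F k x ∂(radialMeasure a r)) atTop ≤ M := by
    -- Fatou in the radius. The weight r^{n-1} is positive for fixed r, so it can be removed from
    -- the conclusion afterwards.
    refine (lintegral_liminf_le hmeas).trans ?_
    exact liminf_le_of_le (by isBoundedDefault) fun b hb => by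
      obtain ⟨k, hk⟩ := hb.exists
      exact hk.trans (h1 k)
  have h3 := ae_lt_top (Measurable.liminf hmeas) (ne_top_of_le_ne_top hM h2)
  filter_upwards [h3, ae_restrict_mem measurableSet_Ioo] with r hr hrR
  by_contra hcon
  rw [not_lt, top_le_iff] at hcon
  have hc : 0 < ENNReal.ofReal (r ^ (n - 1)) := ENNReal.ofReal_pos.2 (pow_pos hrR.1 _)
  have ht : Tendsto (fun k => ∫⁻ x, F k x ∂(radialMeasure a r)) atTop (𝓝 ∞) :=
    tendsto_of_le_liminf_of_limsup_le hcon.ge le_top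
  have ht' := ENNReal.Tendsto.const_mul (a := ENNReal.ofReal (r ^ (n - 1))) ht (Or.inl (by simp))
  rw [ENNReal.mul_top hc.ne'] at ht'
  rw [ht'.liminf_eq] at hr
  exact lt_irrefl _ hr

/-! ### Size of spherical caps -/

theorem measure_ball_radialMeasure {n : ℕ} (hn : n ≠ 0) (a y : RSpace n) (ρ : ℝ) :
    volume (ball y ρ) =
      ∫⁻ t in Ioi (0 : ℝ), ENNReal.ofReal (t ^ (n - 1)) * radialMeasure a t (ball y ρ) := by
  have := lintegral_polar hn a (F := (ball y ρ).indicator 1)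
    (measurable_one.indicator measurableSet_ball)
  simpa only [lintegral_indicator_one measurableSet_ball] using this

/-- Balls move with the radius of the sphere at unit speed. -/
theorem radialMeasure_ball_mono {n : ℕ} (a y : RSpace n) (r t ρ ρ' : ℝ) (h : |t - r| + ρ ≤ ρ') :
    radialMeasure a r (ball y ρ) ≤ radialMeasure a t (ball y ρ') := by
  rw [radialMeasure, radialMeasure, Measure.map_apply (measurable_radial a r) measurableSet_ball,
    Measure.map_apply (measurable_radial a t) measurableSet_ball]
  refine measure_mono fun θ hθ => ?_
  rw [mem_preimage, mem_ball] at hθ ⊢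
  have h1 : dist (a + t • (θ : RSpace n)) (a + r • (θ : RSpace n)) = |t - r| := by
    rw [dist_add_left, dist_eq_norm, ← sub_smul, norm_smul, norm_eq_of_mem_sphere, mul_one,
      Real.norm_eq_abs]
  linarith [dist_triangle (a + t • (θ : RSpace n)) (a + r • (θ : RSpace n)) y]

theorem radialMeasure_ball_eq_zero {n : ℕ} (a y : RSpace n) {r t ρ : ℝ} (hy : y ∈ sphere a r)
    (ht : 0 ≤ t) (h : ρ ≤ |t - r|) : radialMeasure a t (ball y ρ) = 0 := by
  rw [measure_eq_zero_iff_ae_notMem]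
  filter_upwards [radialMeasure_mem_sphere a ht] with x hx hxy
  rw [mem_sphere] at hx hy
  rw [mem_ball] at hxy
  have := abs_dist_sub_le x y a
  rw [hx, hy] at this
  linarith

/-- Thicken the cap radially: for r < t < r + ρ the sphere of radius t meets B(y, 2ρ) in at least as
much cone measure as the sphere of radius r meets B(y, ρ). Integrating in t gives r^{n-1} ρ times
the cap at most |B(y, 2ρ)|. -/
theorem exists_radialMeasure_ball_le {n : ℕ} (hn : n ≠ 0) (a : RSpace n) {r : ℝ} (hr : 0 < r) :
    ∃ C : ℝ≥0∞, C ≠ ∞ ∧ ∀ (y : RSpace n) (ρ : ℝ), 0 < ρ →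
      radialMeasure a r (ball y ρ) ≤ C * ENNReal.ofReal ρ ^ (n - 1) := by
  set A := ENNReal.ofReal (r ^ (n - 1)) with hA
  have hA0 : A ≠ 0 := (ENNReal.ofReal_pos.2 (pow_pos hr _)).ne'
  have hAt : A ≠ ∞ := ENNReal.ofReal_ne_top
  refine ⟨2 ^ n * volume (ball (0 : RSpace n) 1) / A, ?_, fun y ρ hρ => ?_⟩
  · exact ENNReal.div_ne_top (ENNReal.mul_ne_top (by simp) measure_ball_lt_top.ne) hA0
  have hρ0 : ENNReal.ofReal ρ ≠ 0 := (ENNReal.ofReal_pos.2 hρ).ne'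
  have h1 : A * radialMeasure a r (ball y ρ) * ENNReal.ofReal ρ ≤ volume (ball y (2 * ρ)) := by
    rw [measure_ball_radialMeasure hn a]
    calc A * radialMeasure a r (ball y ρ) * ENNReal.ofReal ρ
        = ∫⁻ t in Ioo r (r + ρ), A * radialMeasure a r (ball y ρ) := by
          rw [setLIntegral_const, Real.volume_Ioo, add_sub_cancel_left]
      _ ≤ ∫⁻ t in Ioo r (r + ρ), ENNReal.ofReal (t ^ (n - 1)) *
            radialMeasure a t (ball y (2 * ρ)) := by
          refine setLIntegral_mono' measurableSet_Ioo fun t ht => ?_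
          gcongr ?_ * ?_
          · exact ENNReal.ofReal_le_ofReal (pow_le_pow_left₀ hr.le ht.1.le _)
          · refine radialMeasure_ball_mono a y r t ρ _ ?_
            rw [abs_of_pos (by linarith [ht.1])]
            linarith [ht.2]
      _ ≤ _ := lintegral_mono_set fun t ht => hr.trans ht.1
  rw [Measure.addHaar_ball_of_pos volume _ (by positivity), finrank_euclideanSpace, Fintype.card_fin,
    mul_pow, ENNReal.ofReal_mul (by positivity), ENNReal.ofReal_pow hρ.le n] at h1
  have h2 : ENNReal.ofReal ρ ^ n = ENNReal.ofReal ρ ^ (n - 1) * ENNReal.ofReal ρ := by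
    rw [← pow_succ, Nat.sub_add_cancel (Nat.one_le_iff_ne_zero.2 hn)]
  have h3 : A * radialMeasure a r (ball y ρ) ≤
      2 ^ n * volume (ball (0 : RSpace n) 1) * ENNReal.ofReal ρ ^ (n - 1) := by
    refine (ENNReal.mul_le_mul_iff_left hρ0 ENNReal.ofReal_ne_top).1 (h1.trans (le_of_eq ?_))
    rw [h2, ENNReal.ofReal_pow (by norm_num)]
    simp only [ENNReal.ofReal_ofNat]
    ring
  rw [← ENNReal.mul_div_right_comm, ENNReal.le_div_iff_mul_le (Or.inl hA0) (Or.inl hAt), mul_comm]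
  exact h3

/-- The reverse thickening: B(y, ρ/2) only meets spheres with |t - r| < ρ/2, each in at most the
cone measure of the cap of radius ρ. The condition ρ ≤ r keeps t below 2r and bounds the weight. -/
theorem exists_le_radialMeasure_ball {n : ℕ} (hn : n ≠ 0) (a : RSpace n) {r : ℝ} (hr : 0 < r) :
    ∃ c : ℝ≥0∞, c ≠ 0 ∧ c ≠ ∞ ∧ ∀ y ∈ sphere a r, ∀ ρ : ℝ, 0 < ρ → ρ ≤ r →
      c * ENNReal.ofReal ρ ^ (n - 1) ≤ radialMeasure a r (ball y ρ) := by
  set A := ENNReal.ofReal ((2 * r) ^ (n - 1)) with hA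
  have hA0 : A ≠ 0 := (ENNReal.ofReal_pos.2 (by positivity)).ne'
  have hAt : A ≠ ∞ := ENNReal.ofReal_ne_top
  set V := volume (ball (0 : RSpace n) 1)
  have hV0 : V ≠ 0 := (measure_ball_pos _ _ one_pos).ne'
  have hVt : V ≠ ∞ := measure_ball_lt_top.ne
  have hh0 : ENNReal.ofReal ((1 / 2) ^ n) ≠ 0 := (ENNReal.ofReal_pos.2 (by positivity)).ne'
  refine ⟨ENNReal.ofReal ((1 / 2) ^ n) * V / A, ?_, ?_, fun y hy ρ hρ hρr => ?_⟩
  · exact (ENNReal.div_pos (mul_ne_zero hh0 hV0) hAt).ne'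
  · exact ENNReal.div_ne_top (ENNReal.mul_ne_top ENNReal.ofReal_ne_top hVt) hA0
  have hρ0 : ENNReal.ofReal ρ ≠ 0 := (ENNReal.ofReal_pos.2 hρ).ne'
  have h1 : volume (ball y (1 / 2 * ρ)) ≤
      A * radialMeasure a r (ball y ρ) * ENNReal.ofReal ρ := by
    rw [measure_ball_radialMeasure hn a]
    calc ∫⁻ t in Ioi (0 : ℝ), ENNReal.ofReal (t ^ (n - 1)) *
            radialMeasure a t (ball y (1 / 2 * ρ))
        ≤ ∫⁻ t in Ioi (0 : ℝ), (Ioo (r - ρ / 2) (r + ρ / 2)).indicator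
            (fun _ => A * radialMeasure a r (ball y ρ)) t := by
          refine setLIntegral_mono' measurableSet_Ioi fun t ht => ?_
          have ht0 : 0 < t := ht
          by_cases htr : 1 / 2 * ρ ≤ |t - r|
          · rw [radialMeasure_ball_eq_zero a y hy ht0.le htr, mul_zero]
            exact zero_le
          · have htr' := abs_lt.1 (not_le.1 htr)
            have hmem : t ∈ Ioo (r - ρ / 2) (r + ρ / 2) := ⟨by linarith, by linarith⟩
            rw [indicator_of_mem hmem]
            gcongr ?_ * ?_
            · exact ENNReal.ofReal_le_ofReal (pow_le_pow_left₀ ht0.le (by linarith) _)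
            · refine radialMeasure_ball_mono a y t r _ _ ?_
              rw [abs_sub_comm]
              linarith
      _ ≤ ∫⁻ t, (Ioo (r - ρ / 2) (r + ρ / 2)).indicator
            (fun _ => A * radialMeasure a r (ball y ρ)) t := setLIntegral_le_lintegral _ _
      _ = _ := by
          rw [lintegral_indicator measurableSet_Ioo, setLIntegral_const, Real.volume_Ioo]
          congr 2
          ring
  rw [Measure.addHaar_ball_of_pos volume _ (by positivity), finrank_euclideanSpace, Fintype.card_fin,
    mul_pow, ENNReal.ofReal_mul (by positivity), ENNReal.ofReal_pow hρ.le n] at h1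
  have h2 : ENNReal.ofReal ρ ^ n = ENNReal.ofReal ρ ^ (n - 1) * ENNReal.ofReal ρ := by
    rw [← pow_succ, Nat.sub_add_cancel (Nat.one_le_iff_ne_zero.2 hn)]
  have h3 : ENNReal.ofReal ((1 / 2) ^ n) * V * ENNReal.ofReal ρ ^ (n - 1) ≤
      A * radialMeasure a r (ball y ρ) := by
    refine (ENNReal.mul_le_mul_iff_left hρ0 ENNReal.ofReal_ne_top).1 (le_trans (le_of_eq ?_) h1)
    rw [h2]
    ring
  rw [← ENNReal.mul_div_right_comm, ENNReal.div_le_iff_le_mul (Or.inl hA0) (Or.inl hAt), mul_comm _ A]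
  exact h3

/-! ### Comparison of Hausdorff measure with the cone measure -/

/-- Any two points of a sphere are exchanged by an isometry that preserves the sphere. -/
theorem sphereMeasure_ball_eq {n : ℕ} (a : RSpace n) (r : ℝ) {x y : RSpace n}
    (hx : x ∈ sphere a r) (hy : y ∈ sphere a r) (ρ : ℝ) :
    sphereMeasure a r (ball x ρ) = sphereMeasure a r (ball y ρ) := by
  have hxy : ‖x - a‖ = ‖y - a‖ := by
    rw [mem_sphere_iff_norm.1 hx, mem_sphere_iff_norm.1 hy]
  set e : RSpace n ≃ᵢ RSpace n := ((IsometryEquiv.subRight a).trans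
    (Submodule.reflection (Submodule.span ℝ {(x - a) - (y - a)})ᗮ).toIsometryEquiv).trans
      (IsometryEquiv.addRight a) with he
  have hex : e x = y := by
    have := Submodule.reflection_sub hxy
    simp only [he, IsometryEquiv.trans_apply, IsometryEquiv.subRight_apply,
      LinearIsometryEquiv.coe_toIsometryEquiv, IsometryEquiv.addRight_apply]
    rw [this, sub_add_cancel]
  have hea : e a = a := by simp [he]
  have him : e '' (ball x ρ ∩ sphere a r) = ball y ρ ∩ sphere a r := by
    rw [image_inter e.injective, e.image_ball, e.image_sphere, hex, hea]
  rw [sphereMeasure, Measure.restrict_apply measurableSet_ball,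
    Measure.restrict_apply measurableSet_ball, ← him, e.hausdorffMeasure_image]

theorem isFiniteMeasure_sphereMeasure {n : ℕ} (hn : n ≠ 0) (a : RSpace n) (r : ℝ) :
    IsFiniteMeasure (sphereMeasure a r) := by
  refine ⟨?_⟩
  rw [sphereMeasure, Measure.restrict_apply_univ]
  exact hausdorff_sphere_lt_top hn a r

/-- Tonelli for the symmetric relation dist x y < ρ. -/
theorem lintegral_measure_ball_comm {α : Type*} [PseudoMetricSpace α] [SecondCountableTopology α]
    [MeasurableSpace α] [BorelSpace α] (μ ν : Measure α) [SFinite μ] [SFinite ν] {s t : Set α}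
    (hs : MeasurableSet s) (ht : MeasurableSet t) (ρ : ℝ) :
    ∫⁻ x in s, μ (t ∩ ball x ρ) ∂ν = ∫⁻ y in t, ν (s ∩ ball y ρ) ∂μ := by
  have hm : MeasurableSet {q : α × α | dist q.1 q.2 < ρ} :=
    measurableSet_lt (measurable_fst.dist measurable_snd) measurable_const
  have h1 : ∀ (m : Measure α) (u : Set α) (_ : MeasurableSet u) (x : α),
      m (u ∩ ball x ρ) = ∫⁻ y in u, {q : α × α | dist q.1 q.2 < ρ}.indicator 1 (x, y) ∂m := by
    intro m u hu x
    have : (fun y => {q : α × α | dist q.1 q.2 < ρ}.indicator (1 : α × α → ℝ≥0∞) (x, y)) =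
        (ball x ρ).indicator 1 := by
      ext y
      simp [indicator, dist_comm]
    rw [this, lintegral_indicator_one measurableSet_ball,
      Measure.restrict_apply measurableSet_ball, inter_comm]
  simp_rw [h1 μ t ht, h1 ν s hs]
  rw [lintegral_lintegral_swap]
  · refine lintegral_congr fun y => lintegral_congr fun x => ?_
    simp [indicator, dist_comm]
  · exact (measurable_one.indicator hm).aemeasurable

/-- By symmetry the Hausdorff measure of a cap does not depend on its centre, so it equals its mean
over centres for the cone measure. Tonelli turns this mean into an integral of cone measures of
caps, which are already bounded; finiteness of ℋ^{n-1} on the sphere is all that is used about its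
size. -/
theorem exists_sphereMeasure_ball_le {n : ℕ} (hn : n ≠ 0) (a : RSpace n) {r : ℝ} (hr : 0 < r) :
    ∃ C : ℝ≥0∞, C ≠ ∞ ∧ ∀ x ∈ sphere a r, ∀ ρ : ℝ, 0 < ρ →
      sphereMeasure a r (ball x ρ) ≤ C * ENNReal.ofReal ρ ^ (n - 1) := by
  have := isFiniteMeasure_sphereMeasure hn a r
  obtain ⟨C, hC, h⟩ := exists_radialMeasure_ball_le hn a hr
  have hm0 := radialMeasure_univ_ne_zero hn a r
  refine ⟨C * sphereMeasure a r univ / radialMeasure a r univ, ENNReal.div_ne_top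
    (ENNReal.mul_ne_top hC (measure_ne_top _ _)) hm0, fun x hx ρ hρ => ?_⟩
  have h1 := lintegral_measure_ball_comm (sphereMeasure a r) (radialMeasure a r)
    MeasurableSet.univ MeasurableSet.univ ρ
  simp only [univ_inter, Measure.restrict_univ] at h1
  have h2 : ∫⁻ y, sphereMeasure a r (ball y ρ) ∂(radialMeasure a r) =
      sphereMeasure a r (ball x ρ) * radialMeasure a r univ := by
    rw [← lintegral_const]
    refine lintegral_congr_ae ?_
    filter_upwards [radialMeasure_mem_sphere a hr.le] with y hy
    exact sphereMeasure_ball_eq a r hy hx ρ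
  rw [← ENNReal.mul_div_right_comm, ENNReal.le_div_iff_mul_le (Or.inl hm0)
    (Or.inl (measure_ne_top _ _)), ← h2, h1]
  calc _ ≤ ∫⁻ _, C * ENNReal.ofReal ρ ^ (n - 1) ∂(sphereMeasure a r) :=
        lintegral_mono fun y => h y ρ hρ
    _ = _ := by rw [lintegral_const]; ring

/-- If on the small balls centred at the points of a set carrying `ν` the measure `μ` is at least
`c · g(ρ)` and `ν` is at most `C · g(ρ)`, then `ν ≤ (C / c) μ`. -/
theorem le_smul_of_ball_le {α : Type*} [PseudoMetricSpace α] [SecondCountableTopology α]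
    [MeasurableSpace α] [BorelSpace α] (μ ν : Measure α) [IsFiniteMeasure μ] [IsFiniteMeasure ν]
    {S : Set α} (hμS : ∀ᵐ x ∂μ, x ∈ S) (hνS : ∀ᵐ x ∂ν, x ∈ S) {c C : ℝ≥0∞} (hc0 : c ≠ 0)
    (hc : c ≠ ∞) (hC : C ≠ ∞) {g : ℝ → ℝ≥0∞} {R : ℝ} (hR : 0 < R)
    (hg0 : ∀ ρ, 0 < ρ → g ρ ≠ 0) (hg : ∀ ρ, g ρ ≠ ∞)
    (hμ : ∀ x ∈ S, ∀ ρ, 0 < ρ → ρ ≤ R → c * g ρ ≤ μ (ball x ρ))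
    (hν : ∀ x ∈ S, ∀ ρ, 0 < ρ → ν (ball x ρ) ≤ C * g ρ) : ν ≤ (C / c) • μ := by
  have hCc : C / c ≠ ∞ := ENNReal.div_ne_top hC hc0
  -- For open U, a small ball around x ∈ U lies in U, so μ(U ∩ B(x, ρ)) / (c g(ρ)) is eventually at
  -- least 1. Fatou, Tonelli and the upper bound for ν then give the inequality with no covering
  -- theorem.
  have hopen : ∀ U : Set α, IsOpen U → ν U ≤ (C / c) * μ U := by
    intro U hU
    set ρ : ℕ → ℝ := fun j => R / (j + 1) with hρ
    have hρ0 : ∀ j, 0 < ρ j := fun j => by positivity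
    have hρR : ∀ j, ρ j ≤ R := fun j => div_le_self hR.le (by simp)
    have hρlim : Tendsto ρ atTop (𝓝 0) := by
      have := (tendsto_one_div_add_atTop_nhds_zero_nat (𝕜 := ℝ)).const_mul R
      simpa [hρ, div_eq_mul_inv] using this
    have hmeas : ∀ j, Measurable fun x => μ (U ∩ ball x (ρ j)) := by
      intro j
      have hm : MeasurableSet {q : α × α | q.2 ∈ U ∧ dist q.2 q.1 < ρ j} :=
        (measurable_snd hU.measurableSet).inter
          (measurableSet_lt (measurable_snd.dist measurable_fst) measurable_const)
      exact measurable_measure_prodMk_left hm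
    calc ν U = ∫⁻ x in U, 1 ∂ν := by simp
      _ ≤ ∫⁻ x in U, liminf (fun j => μ (U ∩ ball x (ρ j)) / (c * g (ρ j))) atTop ∂ν := by
          refine lintegral_mono_ae ?_
          filter_upwards [ae_restrict_mem hU.measurableSet, ae_restrict_of_ae hνS] with x hxU hxS
          obtain ⟨ε, hε, hεU⟩ := Metric.isOpen_iff.1 hU x hxU
          refine le_liminf_of_le (by isBoundedDefault) ?_
          filter_upwards [hρlim.eventually_lt_const hε] with j hj
          rw [inter_eq_right.2 ((ball_subset_ball hj.le).trans hεU), ENNReal.le_div_iff_mul_le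
            (Or.inl (mul_ne_zero hc0 (hg0 _ (hρ0 j)))) (Or.inl (ENNReal.mul_ne_top hc (hg _))),
            one_mul]
          exact hμ x hxS _ (hρ0 j) (hρR j)
      _ ≤ liminf (fun j => ∫⁻ x in U, μ (U ∩ ball x (ρ j)) / (c * g (ρ j)) ∂ν) atTop :=
          lintegral_liminf_le fun j => (hmeas j).div_const _
      _ ≤ (C / c) * μ U := by
          refine liminf_le_of_le (by isBoundedDefault) fun b hb => ?_
          obtain ⟨j, hj⟩ := hb.exists
          refine hj.trans ?_
          have hcg : c * g (ρ j) ≠ 0 := mul_ne_zero hc0 (hg0 _ (hρ0 j))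
          simp_rw [div_eq_mul_inv]
          rw [lintegral_mul_const _ (hmeas j), lintegral_measure_ball_comm μ ν hU.measurableSet
            hU.measurableSet, ← div_eq_mul_inv, ENNReal.div_le_iff_le_mul (Or.inl hcg)
              (Or.inl (ENNReal.mul_ne_top hc (hg _)))]
          calc ∫⁻ y in U, ν (U ∩ ball y (ρ j)) ∂μ ≤ ∫⁻ _ in U, C * g (ρ j) ∂μ := by
                refine lintegral_mono_ae ?_
                filter_upwards [ae_restrict_of_ae hμS] with y hy
                exact (measure_mono inter_subset_right).trans (hν y hy _ (hρ0 j))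
            _ = C * g (ρ j) * μ U := by rw [setLIntegral_const]
            _ = (C * (c⁻¹ * c)) * g (ρ j) * μ U := by
                rw [ENNReal.inv_mul_cancel hc0 hc, mul_one]
            _ = _ := by ring
  refine Measure.le_iff.2 fun s _ => ?_
  rw [Measure.smul_apply, smul_eq_mul]
  by_contra! hlt
  -- If the constant were zero, ν would vanish, contrary to the assumed strict inequality. Dividing
  -- by it then makes outer regularity of μ applicable.
  have hK0 : C / c ≠ 0 := by
    intro h0
    have h1 := hopen univ isOpen_univ
    rw [h0, zero_mul, nonpos_iff_eq_zero] at h1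
    exact not_lt_zero (hlt.trans_le ((measure_mono (subset_univ s)).trans h1.le))
  rw [mul_comm, ← ENNReal.lt_div_iff_mul_lt (Or.inl hK0) (Or.inl hCc)] at hlt
  obtain ⟨U, hsU, hU, hUlt⟩ := s.exists_isOpen_lt_of_lt _ hlt
  rw [ENNReal.lt_div_iff_mul_lt (Or.inl hK0) (Or.inl hCc), mul_comm] at hUlt
  exact absurd (hopen U hU) (not_le.2 (hUlt.trans_le (measure_mono hsU)))

/-- This transfers both null sets and integral bounds from the cone measure to ℋ^{n-1}; it combines
the lower cap bound for the former with the upper cap bound for the latter. -/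
theorem exists_sphereMeasure_le_smul {n : ℕ} (hn : n ≠ 0) (a : RSpace n) {r : ℝ} (hr : 0 < r) :
    ∃ C : ℝ≥0∞, C ≠ ∞ ∧ sphereMeasure a r ≤ C • radialMeasure a r := by
  have := isFiniteMeasure_sphereMeasure hn a r
  obtain ⟨C, hC, h⟩ := exists_sphereMeasure_ball_le hn a hr
  obtain ⟨c, hc0, hc, h'⟩ := exists_le_radialMeasure_ball hn a hr
  refine ⟨C / c, ENNReal.div_ne_top hC hc0, le_smul_of_ball_le _ (sphereMeasure a r) (S := sphere a r)
    (radialMeasure_mem_sphere a hr.le) (ae_restrict_mem isClosed_sphere.measurableSet) hc0 hc hC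
    (g := fun ρ => ENNReal.ofReal ρ ^ (n - 1)) hr (fun ρ hρ => ?_) (fun ρ => by simp) h' h⟩
  exact pow_ne_zero _ (ENNReal.ofReal_pos.2 hρ).ne'

/-! ### Boundedness and almost everywhere convergence imply weak convergence in L^q -/

section WeakLp

variable {α E : Type*} [MeasurableSpace α] {μ : Measure α} [NormedAddCommGroup E] {q : ℝ≥0∞}

/-- Multiplication by the indicator function of `A` on `L^q`. -/
def lpCut {A : Set α} (hA : MeasurableSet A) (f : Lp E q μ) : Lp E q μ :=
  ((Lp.memLp f).indicator hA).toLp _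

theorem coeFn_lpCut {A : Set α} (hA : MeasurableSet A) (f : Lp E q μ) :
    lpCut hA f =ᵐ[μ] A.indicator f :=
  MemLp.coeFn_toLp _

theorem enorm_lpCut {A : Set α} (hA : MeasurableSet A) (f : Lp E q μ) :
    ‖lpCut hA f‖ₑ = eLpNorm (A.indicator f) q μ := by
  rw [lpCut, Lp.enorm_toLp]

theorem norm_lpCut_le {A : Set α} (hA : MeasurableSet A) (f : Lp E q μ) :
    ‖lpCut hA f‖ ≤ ‖f‖ := by
  refine Lp.norm_le_norm_of_ae_le ?_
  filter_upwards [coeFn_lpCut hA f] with x hx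
  rw [hx]
  exact norm_indicator_le_norm_self _ _

theorem lpCut_add_compl {A : Set α} (hA : MeasurableSet A) (f : Lp E q μ) :
    lpCut hA f + lpCut hA.compl f = f := by
  refine Lp.ext ?_
  filter_upwards [Lp.coeFn_add (lpCut hA f) (lpCut hA.compl f), coeFn_lpCut hA f,
    coeFn_lpCut hA.compl f] with x h1 h2 h3
  rw [h1, Pi.add_apply, h2, h3]
  exact congrFun (indicator_self_add_compl A f) x

theorem lpCut_congr {A B : Set α} (h : A = B) (hA : MeasurableSet A) (hB : MeasurableSet B)
    (f : Lp E q μ) : lpCut hA f = lpCut hB f := by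
  subst h
  rfl

theorem lpCut_lpCut {A B : Set α} (hA : MeasurableSet A) (hB : MeasurableSet B)
    (f : Lp E q μ) : lpCut hA (lpCut hB f) = lpCut (hA.inter hB) f := by
  refine Lp.ext ?_
  filter_upwards [coeFn_lpCut hA (lpCut hB f), coeFn_lpCut hB f, coeFn_lpCut (hA.inter hB) f]
    with x h1 h2 h3
  rw [h1, h3, inter_comm, ← indicator_indicator]
  by_cases hx : x ∈ A
  · simp only [indicator_of_mem hx]
    rw [h2]
    by_cases hxB : x ∈ B <;> simp [hx, hxB]
  · by_cases hxB : x ∈ B <;> simp [hx, hxB]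

theorem lpCut_add {A : Set α} (hA : MeasurableSet A) (f g : Lp E q μ) :
    lpCut hA (f + g) = lpCut hA f + lpCut hA g := by
  refine Lp.ext ?_
  filter_upwards [coeFn_lpCut hA (f + g), coeFn_lpCut hA f, coeFn_lpCut hA g,
    Lp.coeFn_add (lpCut hA f) (lpCut hA g), Lp.coeFn_add f g] with x h1 h2 h3 h4 h5
  rw [h1, h4, Pi.add_apply, h2, h3]
  by_cases hx : x ∈ A
  · simp only [indicator_of_mem hx]
    rw [h5, Pi.add_apply]
  · simp [hx]

/-- The norm of the sum of two disjointly supported functions of `L^q`. -/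
theorem norm_lpCut_compl_add_lpCut_le [Fact (1 ≤ q)] (hq : q ≠ ∞) {A : Set α}
    (hA : MeasurableSet A) {f g : Lp E q μ} (hf : ‖f‖ ≤ 1) (hg : ‖g‖ ≤ 1) :
    ‖lpCut hA.compl f + lpCut hA g‖ ≤ 2 ^ (1 / q.toReal) := by
  have hq0 : q ≠ 0 := (zero_lt_one.trans_le (Fact.out : 1 ≤ q)).ne'
  have hp : 0 < q.toReal := ENNReal.toReal_pos hq0 hq
  have key : ∀ h : Lp E q μ, ‖h‖ ≤ 1 → ∫⁻ x, ‖h x‖ₑ ^ q.toReal ∂μ ≤ 1 := by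
    intro h hh
    have h1 : eLpNorm h q μ ≤ 1 := by
      rw [← Lp.enorm_def, ← ofReal_norm]
      exact ENNReal.ofReal_le_one.2 hh
    rw [eLpNorm_eq_lintegral_rpow_enorm_toReal hq0 hq] at h1
    have := ENNReal.rpow_le_rpow h1 hp.le
    rwa [one_div, ENNReal.rpow_inv_rpow hp.ne', ENNReal.one_rpow] at this
  have h2 : ∫⁻ x, ‖(lpCut hA.compl f + lpCut hA g : Lp E q μ) x‖ₑ ^ q.toReal ∂μ ≤ 2 := by
    calc _ ≤ ∫⁻ x, (‖f x‖ₑ ^ q.toReal + ‖g x‖ₑ ^ q.toReal) ∂μ := by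
          refine lintegral_mono_ae ?_
          filter_upwards [Lp.coeFn_add (lpCut hA.compl f) (lpCut hA g), coeFn_lpCut hA.compl f,
            coeFn_lpCut hA g] with x h1 h2 h3
          rw [h1, Pi.add_apply, h2, h3]
          by_cases hx : x ∈ A
          · simp [hx]
          · simp [hx]
      _ = ∫⁻ x, ‖f x‖ₑ ^ q.toReal ∂μ + ∫⁻ x, ‖g x‖ₑ ^ q.toReal ∂μ :=
          lintegral_add_left' ((Lp.aestronglyMeasurable f).enorm.pow_const _) _
      _ ≤ 1 + 1 := add_le_add (key f hf) (key g hg)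
      _ = 2 := one_add_one_eq_two
  have h3 : ‖lpCut hA.compl f + lpCut hA g‖ₑ ≤ ENNReal.ofReal (2 ^ (1 / q.toReal)) := by
    rw [Lp.enorm_def, eLpNorm_eq_lintegral_rpow_enorm_toReal hq0 hq,
      ← ENNReal.ofReal_rpow_of_pos (by norm_num), ENNReal.ofReal_ofNat]
    exact ENNReal.rpow_le_rpow h2 (by positivity)
  rw [← ofReal_norm] at h3
  exact (ENNReal.ofReal_le_ofReal_iff (by positivity)).1 h3

variable [Fact (1 ≤ q)]

/-- Absolute continuity of the L^q norm of one fixed function, which needs q < ∞. -/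
theorem exists_forall_norm_lpCut_le (hq : q ≠ ∞) (h : Lp E q μ) {ε : ℝ} (hε : 0 < ε) :
    ∃ δ : ℝ, 0 < δ ∧ ∀ (A : Set α) (hA : MeasurableSet A), μ A ≤ ENNReal.ofReal δ →
      ‖lpCut hA h‖ ≤ ε := by
  obtain ⟨δ, hδ, H⟩ := (Lp.memLp h).eLpNorm_indicator_le Fact.out hq hε
  refine ⟨δ, hδ, fun A hA hμ => ?_⟩
  have := H A hA hμ
  rw [← enorm_lpCut hA, ← ofReal_norm] at this
  exact (ENNReal.ofReal_le_ofReal_iff hε.le).1 this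

variable [NormedSpace ℝ E]

/-- A bounded functional on `L^q`, `1 < q < ∞`, is small on the functions supported in sets of
small measure. -/
theorem exists_forall_apply_lpCut_le (hq1 : 1 < q) (hq : q ≠ ∞) (ℓ : Lp E q μ →L[ℝ] ℝ) {ε : ℝ}
    (hε : 0 < ε) : ∃ δ : ℝ, 0 < δ ∧ ∀ (A : Set α) (hA : MeasurableSet A),
      μ A ≤ ENNReal.ofReal δ → ∀ f : Lp E q μ, ‖f‖ ≤ 1 → ℓ (lpCut hA f) ≤ ε := by
  set T : Set ℝ := {c | 0 ≤ c ∧ ∃ δ : ℝ, 0 < δ ∧ ∀ (A : Set α) (hA : MeasurableSet A),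
    μ A ≤ ENNReal.ofReal δ → ∀ f : Lp E q μ, ‖f‖ ≤ 1 → ℓ (lpCut hA f) ≤ c} with hT
  have hTne : T.Nonempty := by
    refine ⟨‖ℓ‖, norm_nonneg _, 1, one_pos, fun A hA _ f hf => ?_⟩
    refine (Real.le_norm_self _).trans ((ℓ.le_opNorm _).trans ?_)
    exact mul_le_of_le_one_right (norm_nonneg _) ((norm_lpCut_le hA f).trans hf)
  have hTb : BddBelow T := ⟨0, fun c hc => hc.1⟩
  have hup : ∀ c, sInf T < c → ∃ δ : ℝ, 0 < δ ∧ ∀ (A : Set α) (hA : MeasurableSet A),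
      μ A ≤ ENNReal.ofReal δ → ∀ f : Lp E q μ, ‖f‖ ≤ 1 → ℓ (lpCut hA f) ≤ c := by
    intro c hc
    obtain ⟨c', ⟨_, δ, hδ, h⟩, hcc⟩ := exists_lt_of_csInf_lt hTne hc
    exact ⟨δ, hδ, fun A hA hμ f hf => (h A hA hμ f hf).trans hcc.le⟩
  have ha0 : 0 ≤ sInf T := le_csInf hTne fun c hc => hc.1
  rcases ha0.eq_or_lt with h0 | ha
  · exact hup ε (h0 ▸ hε)
  -- Let a > 0 be the optimal asymptotic bound. Choose f on a small set A with ℓ nearly a, then g on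
  -- a set B, again with ℓ nearly a, so small that f is negligible on B. The function equal to f off
  -- B and to g on B has norm at most 2^{1/q} < 2, yet ℓ is nearly 2a on it and its support is still
  -- small.
  exfalso
  set a := sInf T with hadef
  set t : ℝ := 2 ^ (1 / q.toReal) with ht
  have hqr : 1 < q.toReal := by
    rw [← ENNReal.toReal_one]
    exact (ENNReal.toReal_lt_toReal ENNReal.one_ne_top hq).2 hq1
  have ht2 : t < 2 := by
    have : t < (2 : ℝ) ^ (1 : ℝ) := Real.rpow_lt_rpow_of_exponent_lt (by norm_num)
      ((div_lt_one (by linarith)).2 hqr)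
    simpa using this
  have ht0 : 0 < t := by positivity
  -- The contradiction needs 2(1 - η) - η > t(1 + η). Since t < 2 it is enough that 5η < 2 - t.
  set η : ℝ := (2 - t) / 10 with hη
  have hη0 : 0 < η := by rw [hη]; linarith
  obtain ⟨δ, hδ, H⟩ := hup (a * (1 + η)) (by nlinarith)
  have hlow : ∀ δ' : ℝ, 0 < δ' → ∃ (A : Set α) (hA : MeasurableSet A),
      μ A ≤ ENNReal.ofReal δ' ∧ ∃ f : Lp E q μ, ‖f‖ ≤ 1 ∧ a * (1 - η) < ℓ (lpCut hA f) := by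
    intro δ' hδ'
    by_contra! hcon
    have : a ≤ a * (1 - η) := csInf_le hTb
      ⟨mul_nonneg ha0 (by rw [hη]; linarith), δ', hδ', hcon⟩
    nlinarith
  obtain ⟨A, hA, hμA, f, hf, hfA⟩ := hlow (δ / 2) (by positivity)
  obtain ⟨δ₁, hδ₁, H₁⟩ := exists_forall_norm_lpCut_le hq (lpCut hA f)
    (ε := a * η / (‖ℓ‖ + 1)) (by positivity)
  obtain ⟨B, hB, hμB, g, hg, hgB⟩ := hlow (min δ₁ (δ / 2)) (by positivity)
  have hsmall : |ℓ (lpCut hB (lpCut hA f))| ≤ a * η := by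
    have h1 := H₁ B hB (hμB.trans (ENNReal.ofReal_le_ofReal (min_le_left _ _)))
    rw [← Real.norm_eq_abs]
    calc _ ≤ ‖ℓ‖ * ‖lpCut hB (lpCut hA f)‖ := ℓ.le_opNorm _
      _ ≤ (‖ℓ‖ + 1) * (a * η / (‖ℓ‖ + 1)) := by gcongr; linarith
      _ = a * η := by field_simp
  set w := lpCut hB.compl (lpCut hA f) + lpCut hB g with hw
  have hwn : ‖w‖ ≤ t := norm_lpCut_compl_add_lpCut_le hq hB ((norm_lpCut_le hA f).trans hf) hg
  have hwAB : lpCut (hA.union hB) w = w := by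
    rw [hw, lpCut_add, lpCut_lpCut hB.compl hA f, lpCut_lpCut (hA.union hB) (hB.compl.inter hA) f,
      lpCut_lpCut (hA.union hB) hB g]
    have e1 : (A ∪ B) ∩ (Bᶜ ∩ A) = Bᶜ ∩ A := by ext x; simp; tauto
    exact congrArg₂ (· + ·) (lpCut_congr e1 _ _ f) (lpCut_congr (union_inter_cancel_right) _ _ g)
  have hℓw : ℓ w = ℓ (lpCut hA f) - ℓ (lpCut hB (lpCut hA f)) + ℓ (lpCut hB g) := by
    rw [hw, map_add, ← map_sub]
    congr 2
    rw [eq_sub_iff_add_eq, add_comm, lpCut_add_compl]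
  have hμAB : μ (A ∪ B) ≤ ENNReal.ofReal δ := by
    refine (measure_union_le _ _).trans ((add_le_add hμA (hμB.trans
      (ENNReal.ofReal_le_ofReal (min_le_right _ _)))).trans ?_)
    rw [← ENNReal.ofReal_add (by positivity) (by positivity), add_halves]
  have hfin := H (A ∪ B) (hA.union hB) hμAB (t⁻¹ • w) (by
    rw [norm_smul, norm_inv, Real.norm_of_nonneg ht0.le, inv_mul_le_iff₀ ht0]
    simpa using hwn)
  have hcs : lpCut (hA.union hB) (t⁻¹ • w) = t⁻¹ • w := by
    refine Lp.ext ?_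
    have h1 := coeFn_lpCut (hA.union hB) w
    rw [hwAB] at h1
    filter_upwards [coeFn_lpCut (hA.union hB) (t⁻¹ • w), Lp.coeFn_smul t⁻¹ w, h1] with x h2 h3 h4
    rw [h2]
    by_cases hx : x ∈ A ∪ B
    · rw [indicator_of_mem hx]
    · rw [indicator_of_notMem hx, h3, Pi.smul_apply, h4, indicator_of_notMem hx, smul_zero]
  rw [hcs, map_smul, smul_eq_mul, inv_mul_le_iff₀ ht0, hℓw] at hfin
  have h5 := (abs_le.1 hsmall).2
  have h6 : a * (2 * (1 - η) - η) < t * (a * (1 + η)) := by nlinarith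
  have h7 : a * (2 * (1 - η) - η - t * (1 + η)) < 0 := by nlinarith
  have h8 : 0 < 2 * (1 - η) - η - t * (1 + η) := by
    have : t * η ≤ 2 * η := by gcongr
    nlinarith
  nlinarith

/-- In `L^q` of a finite measure, `1 < q < ∞`, a bounded sequence that tends to zero almost
everywhere tends to zero weakly. -/
theorem tendsto_apply_of_ae_tendsto [IsFiniteMeasure μ] (hq1 : 1 < q) (hq : q ≠ ∞)
    (ℓ : Lp E q μ →L[ℝ] ℝ) {h : ℕ → Lp E q μ} {M : ℝ} (hM : ∀ k, ‖h k‖ ≤ M)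
    (hae : ∀ᵐ x ∂μ, Tendsto (fun k => h k x) atTop (𝓝 0)) :
    Tendsto (fun k => ℓ (h k)) atTop (𝓝 0) := by
  have hM0 : 0 ≤ M := (norm_nonneg _).trans (hM 0)
  rw [Metric.tendsto_atTop]
  intro ε hε
  obtain ⟨δ, hδ, H⟩ := exists_forall_apply_lpCut_le hq1 hq ℓ (ε := ε / 2 / (M + 1)) (by positivity)
  have H' : ∀ (A : Set α) (hA : MeasurableSet A), μ A ≤ ENNReal.ofReal δ → ∀ k,
      |ℓ (lpCut hA (h k))| ≤ ε / 2 := by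
    intro A hA hμ k
    have hidem : ∀ c : ℝ, lpCut hA (c • h k) = c • lpCut hA (h k) := by
      intro c
      refine Lp.ext ?_
      filter_upwards [coeFn_lpCut hA (c • h k), coeFn_lpCut hA (h k), Lp.coeFn_smul c (h k),
        Lp.coeFn_smul c (lpCut hA (h k))] with x h1 h2 h3 h4
      rw [h1, h4, Pi.smul_apply, h2]
      by_cases hx : x ∈ A
      · simp only [indicator_of_mem hx]
        rw [h3, Pi.smul_apply]
      · simp [hx]
    -- The smallness statement is one-sided and for the unit ball: apply it with both signs and
    -- after dividing by M + 1.
    have hsc : ∀ σ : ℝ, |σ| = 1 → σ * ℓ (lpCut hA (h k)) ≤ ε / 2 := by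
      intro σ hσ
      have := H A hA hμ ((σ * (M + 1)⁻¹) • h k) (by
        rw [norm_smul, Real.norm_eq_abs, abs_mul, hσ, one_mul, abs_of_pos (by positivity),
          inv_mul_le_iff₀ (by positivity)]
        linarith [hM k])
      rw [hidem, map_smul, smul_eq_mul, le_div_iff₀ (by positivity)] at this
      refine le_trans (le_of_eq ?_) this
      field_simp
    refine abs_le.2 ⟨?_, ?_⟩
    · linarith [hsc (-1) (by simp)]
    · linarith [hsc 1 (by simp)]
  -- Egorov: convergence is uniform off a set t of measure at most δ. On t the functional is
  -- uniformly small; off t the norm itself tends to zero since μ is finite.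
  obtain ⟨t, htm, hμt, hunif⟩ := tendstoUniformlyOn_of_ae_tendsto' (μ := μ)
    (fun k => Lp.stronglyMeasurable (h k)) (stronglyMeasurable_const (b := (0 : E))) hae hδ
  set K : ℝ := (‖ℓ‖ + 1) * (measureUnivNNReal μ ^ q.toReal⁻¹ + 1) with hK
  have hKpos : 0 < K := by positivity
  obtain ⟨k₀, hk₀⟩ := eventually_atTop.1
    (Metric.tendstoUniformlyOn_iff.1 hunif (ε / 4 / K) (by positivity))
  refine ⟨k₀, fun k hk => ?_⟩
  have hn : ‖lpCut htm.compl (h k)‖ ≤ measureUnivNNReal μ ^ q.toReal⁻¹ * (ε / 4 / K) := by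
    refine Lp.norm_le_of_ae_bound (by positivity) ?_
    filter_upwards [coeFn_lpCut htm.compl (h k)] with x hx
    rw [hx]
    by_cases hxt : x ∈ tᶜ
    · rw [indicator_of_mem hxt]
      have := hk₀ k hk x hxt
      rw [dist_zero_left] at this
      exact this.le
    · rw [indicator_of_notMem hxt, norm_zero]
      positivity
  have h2 : |ℓ (lpCut htm.compl (h k))| ≤ ε / 4 := by
    rw [← Real.norm_eq_abs]
    calc _ ≤ ‖ℓ‖ * ‖lpCut htm.compl (h k)‖ := ℓ.le_opNorm _
      _ ≤ (‖ℓ‖ + 1) * ((measureUnivNNReal μ ^ q.toReal⁻¹ + 1) * (ε / 4 / K)) := by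
          gcongr
          · linarith
          · refine hn.trans ?_
            gcongr
            linarith
      _ = ε / 4 := by rw [hK]; field_simp
  rw [dist_zero_right, Real.norm_eq_abs, ← lpCut_add_compl htm (h k), map_add]
  have := H' t htm hμt k
  linarith [abs_add_le (ℓ (lpCut htm (h k))) (ℓ (lpCut htm.compl (h k)))]

end WeakLp

/-! ### Fractional Sobolev spaces inside products of L^p spaces -/

/-- A functional dominated by `‖T ·‖` factors through `T` and extends continuously. -/
theorem exists_extension_comp {V X : Type*} [AddCommGroup V] [Module ℝ V]
    [SeminormedAddCommGroup X] [NormedSpace ℝ X] (T : V →ₗ[ℝ] X) (L : V →ₗ[ℝ] ℝ) {C : ℝ}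
    (hC : ∀ w, |L w| ≤ C * ‖T w‖) : ∃ ℓ : X →L[ℝ] ℝ, ∀ w, L w = ℓ (T w) := by
  -- A purely linear section of T onto its range. The composite L ∘ g is bounded for the norm of X
  -- although g has no continuity, so Hahn–Banach applies.
  obtain ⟨g, hg⟩ := T.rangeRestrict.exists_rightInverse_of_surjective T.range_rangeRestrict
  have hgT : ∀ y, T (g y) = y := fun y => congrArg Subtype.val (LinearMap.congr_fun hg y)
  obtain ⟨ℓ, hℓ, -⟩ := exists_extension_norm_eq (LinearMap.range T)
    ((L ∘ₗ g).mkContinuous C fun y => by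
      have := hC (g y)
      rw [hgT] at this
      exact this)
  refine ⟨ℓ, fun w => ?_⟩
  have h1 := hℓ (T.rangeRestrict w)
  change ℓ (T w) = L (g (T.rangeRestrict w)) at h1
  rw [h1]
  -- The hypothesis makes L vanish on the kernel of T, so the choice of section is immaterial.
  have h2 := hC (w - g (T.rangeRestrict w))
  rw [map_sub, map_sub, hgT] at h2
  have hz : ‖T w - (T.rangeRestrict w : X)‖ = 0 := by
    change ‖T w - T w‖ = 0
    simp
  rw [hz, mul_zero] at h2
  exact sub_eq_zero.1 (abs_nonpos_iff.1 h2)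

section Embedding

variable {n : ℕ} (d s p : ℝ) (μ : Measure (RSpace n))

/-- The difference quotient whose `L^p` norm is the Gagliardo seminorm. -/
def gagliardoQuotient (u : RSpace n → RSpace n) (z : RSpace n × RSpace n) : RSpace n :=
  (‖z.1 - z.2‖ ^ ((d + s * p) / p))⁻¹ • (u z.1 - u z.2)

variable {p}

theorem enorm_gagliardoQuotient_rpow (hp : 1 ≤ p) (u : RSpace n → RSpace n)
    (z : RSpace n × RSpace n) : ‖gagliardoQuotient d s p u z‖ₑ ^ p =
      ‖u z.1 - u z.2‖ₑ ^ p / ‖z.1 - z.2‖ₑ ^ (d + s * p) := by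
  have hp0 : 0 < p := by linarith
  rw [gagliardoQuotient]
  -- On the diagonal both numerators vanish, so both sides are 0 whatever the value of the singular
  -- factor.
  by_cases h : z.1 = z.2
  · simp [h, hp0]
  · have hpos : 0 < ‖z.1 - z.2‖ := norm_pos_iff.2 (sub_ne_zero.2 h)
    have h1 : ‖(‖z.1 - z.2‖ ^ ((d + s * p) / p))⁻¹‖ₑ = (‖z.1 - z.2‖ₑ ^ ((d + s * p) / p))⁻¹ := by
      rw [enorm_inv (Real.rpow_pos_of_pos hpos _).ne',
        Real.enorm_eq_ofReal (Real.rpow_nonneg hpos.le _), ← ENNReal.ofReal_rpow_of_pos hpos,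
        ofReal_norm]
    rw [enorm_smul, h1, ENNReal.mul_rpow_of_nonneg _ _ hp0.le, ENNReal.inv_rpow,
      ← ENNReal.rpow_mul, div_mul_cancel₀ _ hp0.ne', mul_comm, ← div_eq_mul_inv]

variable {μ}

theorem aestronglyMeasurable_gagliardoQuotient [SFinite μ] {u : RSpace n → RSpace n}
    (hu : AEStronglyMeasurable u μ) :
    AEStronglyMeasurable (gagliardoQuotient d s p u) (μ.prod μ) := by
  refine AEStronglyMeasurable.smul (f := fun z : RSpace n × RSpace n =>
    (‖z.1 - z.2‖ ^ ((d + s * p) / p))⁻¹) ?_ ((hu.comp_fst).sub (hu.comp_snd))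
  exact Measurable.aestronglyMeasurable (by fun_prop)

theorem lintegral_gagliardoQuotient (hp : 1 ≤ p) [SFinite μ] {u : RSpace n → RSpace n}
    (hu : AEStronglyMeasurable u μ) :
    ∫⁻ z, ‖gagliardoQuotient d s p u z‖ₑ ^ p ∂(μ.prod μ) = gagliardoPow d s p μ u := by
  simp_rw [enorm_gagliardoQuotient_rpow d s hp]
  rw [lintegral_prod _ (gagliardo_aemeasurable d s p μ hu), gagliardoPow]

theorem eLpNorm_eq_lintegral_ofReal {α E : Type*} [MeasurableSpace α] [NormedAddCommGroup E] (hp : 1 ≤ p)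
    (f : α → E) (m : Measure α) :
    eLpNorm f (ENNReal.ofReal p) m = (∫⁻ x, ‖f x‖ₑ ^ p ∂m) ^ (1 / p) := by
  have hp0 : 0 < p := by linarith
  rw [eLpNorm_eq_lintegral_rpow_enorm_toReal (ENNReal.ofReal_pos.2 hp0).ne' ENNReal.ofReal_ne_top,
    ENNReal.toReal_ofReal hp0.le]

theorem memLp_ofReal_iff {α E : Type*} [MeasurableSpace α] [NormedAddCommGroup E] (hp : 1 ≤ p)
    {f : α → E} {m : Measure α} (hf : AEStronglyMeasurable f m) :
    MemLp f (ENNReal.ofReal p) m ↔ ∫⁻ x, ‖f x‖ₑ ^ p ∂m < ∞ := by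
  have hp0 : 0 < p := by linarith
  rw [MemLp, eLpNorm_eq_lintegral_ofReal hp, and_iff_right hf,
    ENNReal.rpow_lt_top_iff_of_pos (by positivity)]

theorem memLp_gagliardoQuotient (hp : 1 ≤ p) [SFinite μ] {u : RSpace n → RSpace n}
    (hu : u ∈ fracSobolev d s p hp μ) :
    MemLp (gagliardoQuotient d s p u) (ENNReal.ofReal p) (μ.prod μ) := by
  rw [memLp_ofReal_iff hp (aestronglyMeasurable_gagliardoQuotient d s hu.1.1),
    lintegral_gagliardoQuotient d s hp hu.1.1]
  exact hu.2

variable (μ) in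
/-- The embedding of `W^{s,p}` in a product of `L^p` spaces given by a function and its
difference quotient. -/
def sobolevEmbedding (hp : 1 ≤ p) [SFinite μ] : fracSobolev d s p hp μ →ₗ[ℝ]
    Lp (RSpace n) (ENNReal.ofReal p) μ × Lp (RSpace n) (ENNReal.ofReal p) (μ.prod μ) where
  toFun u := (u.2.1.toLp _, (memLp_gagliardoQuotient d s hp u.2).toLp _)
  map_add' u v := by
    ext1
    · exact MemLp.toLp_add u.2.1 v.2.1
    · refine (MemLp.toLp_congr (memLp_gagliardoQuotient d s hp (u + v).2)
        ((memLp_gagliardoQuotient d s hp u.2).add (memLp_gagliardoQuotient d s hp v.2))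
        (ae_of_all _ fun z => ?_)).trans (MemLp.toLp_add (memLp_gagliardoQuotient d s hp u.2)
          (memLp_gagliardoQuotient d s hp v.2))
      simp only [gagliardoQuotient, Submodule.coe_add, Pi.add_apply]
      rw [← smul_add]
      congr 1
      abel
  map_smul' c u := by
    ext1
    · exact MemLp.toLp_const_smul c u.2.1
    · refine (MemLp.toLp_congr (memLp_gagliardoQuotient d s hp (c • u).2)
        ((memLp_gagliardoQuotient d s hp u.2).const_smul c)
        (ae_of_all _ fun z => ?_)).trans
          (MemLp.toLp_const_smul c (memLp_gagliardoQuotient d s hp u.2))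
      simp only [gagliardoQuotient, Submodule.coe_smul, Pi.smul_apply]
      rw [← smul_sub, smul_comm]

/-- The power 1/p is subadditive because p ≥ 1. -/
theorem fracSobolevNorm_le (hp : 1 ≤ p) [SFinite μ] (u : fracSobolev d s p hp μ) :
    fracSobolevNorm d s p μ u.1 ≤
      ‖(sobolevEmbedding d s μ hp u).1‖ + ‖(sobolevEmbedding d s μ hp u).2‖ := by
  have hp0 : 0 < p := by linarith
  have h1 := (memLp_ofReal_iff hp u.2.1.1).1 u.2.1
  have h2 := u.2.2
  have e1 : ‖(sobolevEmbedding d s μ hp u).1‖ = ((∫⁻ x, ‖u.1 x‖ₑ ^ p ∂μ) ^ (1 / p)).toReal := by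
    rw [← eLpNorm_eq_lintegral_ofReal hp]
    exact Lp.norm_toLp _ u.2.1
  have e2 : ‖(sobolevEmbedding d s μ hp u).2‖ = ((gagliardoPow d s p μ u.1) ^ (1 / p)).toReal := by
    rw [← lintegral_gagliardoQuotient d s hp u.2.1.1, ← eLpNorm_eq_lintegral_ofReal hp]
    exact Lp.norm_toLp _ (memLp_gagliardoQuotient d s hp u.2)
  have t1 := (ENNReal.rpow_lt_top_of_nonneg (by positivity : 0 ≤ 1 / p) h1.ne).ne
  have t2 := (ENNReal.rpow_lt_top_of_nonneg (by positivity : 0 ≤ 1 / p) h2.ne).ne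
  rw [e1, e2, fracSobolevNorm, ← ENNReal.toReal_add t1 t2]
  refine ENNReal.toReal_mono (ENNReal.add_ne_top.2 ⟨t1, t2⟩) ?_
  exact ENNReal.rpow_add_le_add_rpow _ _ (by positivity) ((div_le_one hp0).2 hp)

theorem norm_sobolevEmbedding_le (hp : 1 ≤ p) [SFinite μ] (u : fracSobolev d s p hp μ) :
    ‖sobolevEmbedding d s μ hp u‖ ≤ fracSobolevNorm d s p μ u.1 := by
  have hp0 : 0 < p := by linarith
  have h1 := (memLp_ofReal_iff hp u.2.1.1).1 u.2.1
  have h2 := u.2.2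
  have e1 : ‖(sobolevEmbedding d s μ hp u).1‖ = ((∫⁻ x, ‖u.1 x‖ₑ ^ p ∂μ) ^ (1 / p)).toReal := by
    rw [← eLpNorm_eq_lintegral_ofReal hp]
    exact Lp.norm_toLp _ u.2.1
  have e2 : ‖(sobolevEmbedding d s μ hp u).2‖ = ((gagliardoPow d s p μ u.1) ^ (1 / p)).toReal := by
    rw [← lintegral_gagliardoQuotient d s hp u.2.1.1, ← eLpNorm_eq_lintegral_ofReal hp]
    exact Lp.norm_toLp _ (memLp_gagliardoQuotient d s hp u.2)
  have t := (ENNReal.rpow_lt_top_of_nonneg (by positivity : 0 ≤ 1 / p)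
    (ENNReal.add_lt_top.2 ⟨h1, h2⟩).ne).ne
  rw [Prod.norm_def, e1, e2, fracSobolevNorm]
  refine max_le (ENNReal.toReal_mono t ?_) (ENNReal.toReal_mono t ?_)
  · exact ENNReal.rpow_le_rpow le_self_add (by positivity)
  · exact ENNReal.rpow_le_rpow le_add_self (by positivity)

/-- Every bounded functional on `W^{s,p}` is the restriction of one on the product of `L^p`
spaces. -/
theorem exists_extension_sobolev (hp : 1 ≤ p) [Fact (1 ≤ ENNReal.ofReal p)] [SFinite μ]
    (L : fracSobolev d s p hp μ →ₗ[ℝ] ℝ) {C : ℝ}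
    (hC : ∀ w : fracSobolev d s p hp μ, |L w| ≤ C * fracSobolevNorm d s p μ w.1) :
    ∃ ℓ : (Lp (RSpace n) (ENNReal.ofReal p) μ × Lp (RSpace n) (ENNReal.ofReal p) (μ.prod μ))
      →L[ℝ] ℝ, ∀ w, L w = ℓ (sobolevEmbedding d s μ hp w) := by
  have hnn : ∀ w : fracSobolev d s p hp μ, 0 ≤ fracSobolevNorm d s p μ w.1 :=
    fun w => ENNReal.toReal_nonneg
  -- The factor 2 passes from the sum of the two component norms to the maximum norm of the product;
  -- |C| allows a negative C.
  refine exists_extension_comp (sobolevEmbedding d s μ hp) L (C := |C| * 2) fun w => ?_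
  rw [mul_assoc]
  refine (hC w).trans (mul_le_mul (le_abs_self C) ((fracSobolevNorm_le d s hp w).trans ?_)
    (hnn w) (abs_nonneg _))
  rw [two_mul]
  exact add_le_add (norm_fst_le _) (norm_snd_le _)

/-- Weakly convergent sequences are bounded. -/
theorem WeaklyConverges.exists_bound {hp : 1 ≤ p} [SFinite μ] {u : ℕ → RSpace n → RSpace n}
    {v : RSpace n → RSpace n} (h : WeaklyConverges d s p hp μ u v) :
    ∃ M : ℝ≥0∞, M ≠ ∞ ∧ ∀ k, ∫⁻ x, ‖u k x‖ₑ ^ p ∂μ + gagliardoPow d s p μ (u k) ≤ M := by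
  have hp0 : 0 < p := by linarith
  have : Fact (1 ≤ ENNReal.ofReal p) := ⟨by simpa using ENNReal.ofReal_le_ofReal hp⟩
  obtain ⟨hu, hv, H⟩ := h
  set T := sobolevEmbedding d s μ hp with hT
  -- Uniform boundedness is applied to the evaluations at `T (u k)` on the dual of the product,
  -- which is complete; completeness of W^{s,p} itself is not needed. Each ℓ ∘ T is an admissible
  -- test functional, and the embedding in the bidual is isometric.
  obtain ⟨B, hB⟩ := banach_steinhaus
    (g := fun k => NormedSpace.inclusionInDoubleDualLi ℝ (T ⟨u k, hu k⟩)) fun ℓ => by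
      have h1 := H (ℓ.toLinearMap ∘ₗ T) ⟨‖ℓ‖, fun w => by
        refine (ℓ.le_opNorm _).trans ?_
        gcongr
        exact norm_sobolevEmbedding_le d s hp w⟩
      obtain ⟨C, hC⟩ := h1.norm.bddAbove_range
      exact ⟨C, fun k => hC ⟨k, rfl⟩⟩
  refine ⟨ENNReal.ofReal (2 * B) ^ p, ENNReal.rpow_ne_top_of_nonneg hp0.le
    ENNReal.ofReal_ne_top, fun k => ?_⟩
  have h1 : ‖T ⟨u k, hu k⟩‖ ≤ B := by
    have := hB k
    rwa [LinearIsometry.norm_map] at this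
  have h2 : fracSobolevNorm d s p μ (u k) ≤ 2 * B := by
    refine (fracSobolevNorm_le d s hp ⟨u k, hu k⟩).trans ?_
    linarith [norm_fst_le (T ⟨u k, hu k⟩), norm_snd_le (T ⟨u k, hu k⟩)]
  have hfin : (∫⁻ x, ‖u k x‖ₑ ^ p ∂μ + gagliardoPow d s p μ (u k)) ^ (1 / p) ≠ ∞ :=
    (ENNReal.rpow_lt_top_of_nonneg (by positivity) (ENNReal.add_lt_top.2
      ⟨(memLp_ofReal_iff hp (hu k).1.1).1 (hu k).1, (hu k).2⟩).ne).ne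
  have h3 := ENNReal.rpow_le_rpow ((ENNReal.le_ofReal_iff_toReal_le hfin
    (ENNReal.toReal_nonneg.trans h2)).2 h2) hp0.le
  rwa [one_div, ENNReal.rpow_inv_rpow hp0.ne'] at h3

/-- A bounded sequence of `W^{s,p}` that converges almost everywhere converges weakly. -/
theorem weaklyConverges_of_ae_tendsto (hp : 1 < p) [IsFiniteMeasure μ]
    {u : ℕ → RSpace n → RSpace n} {v : RSpace n → RSpace n}
    (hu : ∀ k, AEStronglyMeasurable (u k) μ) (hv : v ∈ fracSobolev d s p hp.le μ) {M : ℝ≥0∞}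
    (hM : M ≠ ∞) (hub : ∀ k, ∫⁻ x, ‖u k x‖ₑ ^ p ∂μ + gagliardoPow d s p μ (u k) ≤ M)
    (hae : ∀ᵐ x ∂μ, Tendsto (fun k => u k x) atTop (𝓝 (v x))) :
    WeaklyConverges d s p hp.le μ u v := by
  have hp0 : 0 < p := by linarith
  have hfact : Fact (1 ≤ ENNReal.ofReal p) := ⟨by simpa using ENNReal.ofReal_le_ofReal hp.le⟩
  have hq1 : 1 < ENNReal.ofReal p := by simpa using hp
  have hmem : ∀ k, u k ∈ fracSobolev d s p hp.le μ := fun k =>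
    ⟨(memLp_ofReal_iff hp.le (hu k)).2 ((le_self_add.trans (hub k)).trans_lt hM.lt_top),
      (le_add_self.trans (hub k)).trans_lt hM.lt_top⟩
  refine ⟨hmem, hv, fun L ⟨C, hC⟩ => ?_⟩
  obtain ⟨ℓ, hℓ⟩ := exists_extension_sobolev d s hp.le L hC
  set T := sobolevEmbedding d s μ hp.le with hT
  set vv : fracSobolev d s p hp.le μ := ⟨v, hv⟩
  set uu : ℕ → fracSobolev d s p hp.le μ := fun k => ⟨u k, hmem k⟩ with huu
  have hbound : ∀ k, ‖T (uu k - vv)‖ ≤ (M ^ (1 / p)).toReal + ‖T vv‖ := by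
    intro k
    rw [map_sub]
    refine (norm_sub_le _ _).trans ?_
    gcongr
    refine (norm_sobolevEmbedding_le d s hp.le (uu k)).trans ?_
    refine ENNReal.toReal_mono (ENNReal.rpow_lt_top_of_nonneg (by positivity) hM).ne ?_
    exact ENNReal.rpow_le_rpow (hub k) (by positivity)
  -- The extended functional splits over the two factors. In each, the component of u_k - v is
  -- bounded in L^p and tends to zero almost everywhere.
  have h1 : Tendsto (fun k => ℓ ((T (uu k - vv)).1, 0)) atTop (𝓝 0) := by
    refine tendsto_apply_of_ae_tendsto hq1 ENNReal.ofReal_ne_top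
      (ℓ ∘L ContinuousLinearMap.inl ℝ _ _) (fun k => (norm_fst_le _).trans (hbound k)) ?_
    have hco := ae_all_iff.2 fun k => (uu k - vv).2.1.coeFn_toLp
    filter_upwards [hae, hco] with x hx hx2
    have : Tendsto (fun k => u k x - v x) atTop (𝓝 0) := by
      simpa using hx.sub_const (v x)
    exact this.congr fun k => (hx2 k).symm
  have h2 : Tendsto (fun k => ℓ (0, (T (uu k - vv)).2)) atTop (𝓝 0) := by
    refine tendsto_apply_of_ae_tendsto hq1 ENNReal.ofReal_ne_top
      (ℓ ∘L ContinuousLinearMap.inr ℝ _ _) (fun k => (norm_snd_le _).trans (hbound k)) ?_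
    have hco := ae_all_iff.2 fun k =>
      (memLp_gagliardoQuotient d s hp.le (uu k - vv).2).coeFn_toLp
    filter_upwards [(Measure.quasiMeasurePreserving_fst (μ := μ) (ν := μ)).ae hae,
      (Measure.quasiMeasurePreserving_snd (μ := μ) (ν := μ)).ae hae, hco] with z hz1 hz2 hz3
    have : Tendsto (fun k => gagliardoQuotient d s p (u k - v) z) atTop (𝓝 0) := by
      have h0 := ((hz1.sub_const (v z.1)).sub (hz2.sub_const (v z.2))).const_smul
        ((‖z.1 - z.2‖ ^ ((d + s * p) / p))⁻¹)
      rw [sub_self, sub_self, sub_self, smul_zero] at h0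
      exact h0
    exact this.congr fun k => (hz3 k).symm
  have h3 := (h1.add h2).add_const (L vv)
  rw [add_zero, zero_add] at h3
  refine h3.congr fun k => ?_
  rw [← map_add, Prod.mk_add_mk, add_zero, zero_add, Prod.mk.eta, ← hℓ, map_sub, sub_add_cancel]

end Embedding

/-! ### The slicing estimate -/

/-- The inner integral of the Gagliardo seminorm. -/
def gagliardoDensity {n : ℕ} (d s p : ℝ) (μ : Measure (RSpace n)) (u : RSpace n → RSpace n)
    (x : RSpace n) : ℝ≥0∞ :=
  ∫⁻ z, ‖u x - u z‖ₑ ^ p / ‖x - z‖ₑ ^ (d + s * p) ∂μ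

theorem measurable_gagliardoDensity {n : ℕ} (d s p : ℝ) (μ : Measure (RSpace n)) [SFinite μ]
    {u : RSpace n → RSpace n} (hu : Measurable u) : Measurable (gagliardoDensity d s p μ u) := by
  refine Measurable.lintegral_prod_right' (f := fun q : RSpace n × RSpace n =>
    ‖u q.1 - u q.2‖ₑ ^ p / ‖q.1 - q.2‖ₑ ^ (d + s * p)) ?_
  fun_prop

/-- A negative power of the distance, integrated away from its singularity against a measure
whose balls have the size of balls in dimension `m`. -/
theorem lintegral_enorm_rpow_neg_le {n m : ℕ} (σ : Measure (RSpace n)) (x : RSpace n) {C : ℝ≥0∞}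
    (hσ : ∀ ρ : ℝ, 0 < ρ → σ (ball x ρ) ≤ C * ENNReal.ofReal ρ ^ m) {b δ : ℝ} (hb : 1 ≤ b)
    (hδ : 0 < δ) : ∫⁻ y in {y | δ ≤ ‖x - y‖}, ‖x - y‖ₑ ^ (-(m + b)) ∂σ ≤
      C * 2 ^ m * 2 * ENNReal.ofReal δ ^ (-b) := by
  -- Dyadic annuli: the j-th contributes at most C 2^m (2^j δ)^{-b}, where 2^m comes from its outer
  -- radius being twice the inner one.
  have hcover : {y | δ ≤ ‖x - y‖} ⊆ ⋃ j : ℕ, {y | 2 ^ j * δ ≤ ‖x - y‖ ∧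
      ‖x - y‖ < 2 ^ (j + 1) * δ} := by
    intro y hy
    have hy1 : 1 ≤ ‖x - y‖ / δ := by rw [one_le_div hδ]; exact hy
    obtain ⟨j, hj1, hj2⟩ := exists_nat_pow_near hy1 (one_lt_two (α := ℝ))
    refine mem_iUnion.2 ⟨j, ?_, ?_⟩
    · rwa [le_div_iff₀ hδ] at hj1
    · rwa [div_lt_iff₀ hδ] at hj2
  have hd : Measurable fun y => ‖x - y‖ := by fun_prop
  have hterm : ∀ j : ℕ, ∫⁻ y in {y | 2 ^ j * δ ≤ ‖x - y‖ ∧ ‖x - y‖ < 2 ^ (j + 1) * δ},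
      ‖x - y‖ₑ ^ (-(m + b)) ∂σ ≤ C * 2 ^ m * ENNReal.ofReal δ ^ (-b) * 2⁻¹ ^ j := by
    intro j
    have hpos : 0 < 2 ^ j * δ := by positivity
    set t := ENNReal.ofReal (2 ^ j * δ) with ht
    have ht0 : t ≠ 0 := (ENNReal.ofReal_pos.2 hpos).ne'
    have htt : t ≠ ∞ := ENNReal.ofReal_ne_top
    have hmeas : MeasurableSet {y | 2 ^ j * δ ≤ ‖x - y‖ ∧ ‖x - y‖ < 2 ^ (j + 1) * δ} :=
      (measurableSet_le measurable_const hd).inter (measurableSet_lt hd measurable_const)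
    -- Since b ≥ 1, 2^{-jb} is at most 2^{-j}; the geometric series then has sum 2 independently of
    -- b.
    have hb2 : t ^ (-b) ≤ ENNReal.ofReal δ ^ (-b) * 2⁻¹ ^ j := by
      rw [ht, ENNReal.ofReal_mul (by positivity), ENNReal.mul_rpow_of_ne_top
        ENNReal.ofReal_ne_top ENNReal.ofReal_ne_top, mul_comm]
      refine mul_le_mul_right ?_ _
      rw [ENNReal.ofReal_pow (by norm_num), ENNReal.ofReal_ofNat, ENNReal.rpow_neg,
        ← ENNReal.inv_pow]
      refine ENNReal.inv_le_inv.2 ?_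
      calc (2 : ℝ≥0∞) ^ j = (2 ^ j) ^ (1 : ℝ) := (ENNReal.rpow_one _).symm
        _ ≤ (2 ^ j) ^ b := ENNReal.rpow_le_rpow_of_exponent_le (one_le_pow₀ one_le_two) hb
    calc _ ≤ ∫⁻ y in {y | 2 ^ j * δ ≤ ‖x - y‖ ∧ ‖x - y‖ < 2 ^ (j + 1) * δ},
          t ^ (-(m + b)) ∂σ := by
          refine setLIntegral_mono' hmeas fun y hy => ?_
          rw [ENNReal.rpow_neg, ENNReal.rpow_neg]
          refine ENNReal.inv_le_inv.2 (ENNReal.rpow_le_rpow ?_ (by positivity))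
          rw [← ofReal_norm]
          exact ENNReal.ofReal_le_ofReal hy.1
      _ = t ^ (-(m + b)) * σ {y | 2 ^ j * δ ≤ ‖x - y‖ ∧ ‖x - y‖ < 2 ^ (j + 1) * δ} :=
          setLIntegral_const _ _
      _ ≤ t ^ (-(m + b)) * (C * (2 ^ m * t ^ m)) := by
          refine mul_le_mul_right ((measure_mono fun y hy => ?_).trans
            ((hσ (2 * (2 ^ j * δ)) (by positivity)).trans (le_of_eq ?_))) _
          · rw [mem_ball, dist_comm, dist_eq_norm]
            refine hy.2.trans_eq ?_
            ring
          · rw [ENNReal.ofReal_mul (by norm_num), mul_pow, ENNReal.ofReal_ofNat]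
      _ = C * 2 ^ m * t ^ (-b) := by
          have : t ^ (-b) = t ^ (-(m + b)) * t ^ m := by
            rw [← ENNReal.rpow_natCast t m, ← ENNReal.rpow_add _ _ ht0 htt]
            congr 1
            ring
          rw [this]
          ring
      _ ≤ C * 2 ^ m * (ENNReal.ofReal δ ^ (-b) * 2⁻¹ ^ j) := mul_le_mul_right hb2 _
      _ = _ := by ring
  calc _ ≤ ∫⁻ y in ⋃ j : ℕ, {y | 2 ^ j * δ ≤ ‖x - y‖ ∧ ‖x - y‖ < 2 ^ (j + 1) * δ},
        ‖x - y‖ₑ ^ (-(m + b)) ∂σ := lintegral_mono_set hcover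
    _ ≤ ∑' j : ℕ, ∫⁻ y in {y | 2 ^ j * δ ≤ ‖x - y‖ ∧ ‖x - y‖ < 2 ^ (j + 1) * δ},
        ‖x - y‖ₑ ^ (-(m + b)) ∂σ := lintegral_iUnion_le _ _
    _ ≤ ∑' j : ℕ, C * 2 ^ m * ENNReal.ofReal δ ^ (-b) * 2⁻¹ ^ j := ENNReal.tsum_le_tsum hterm
    _ = _ := by
      rw [ENNReal.tsum_mul_left, ENNReal.tsum_geometric, ENNReal.one_sub_inv_two, inv_inv]
      ring

/-- The integrand of the triple integral in the slicing estimate. -/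
def slicingKernel {n : ℕ} (p e : ℝ) (u : RSpace n → RSpace n) (x y z : RSpace n) : ℝ≥0∞ :=
  {q : RSpace n × RSpace n × RSpace n | ‖q.1 - q.2.2‖ ≤ 2 * ‖q.1 - q.2.1‖}.indicator
    (fun q => ‖u q.1 - u q.2.2‖ₑ ^ p * ‖q.1 - q.2.1‖ₑ ^ (-e)) (x, y, z)

theorem measurable_slicingKernel {n : ℕ} (p e : ℝ) {u : RSpace n → RSpace n} (hu : Measurable u) :
    Measurable fun q : RSpace n × RSpace n × RSpace n => slicingKernel p e u q.1 q.2.1 q.2.2 := by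
  refine Measurable.indicator (by fun_prop) ?_
  exact measurableSet_le (by fun_prop) (by fun_prop)

theorem measurable_slicingKernel_comp {n : ℕ} {α : Type*} [MeasurableSpace α] (p e : ℝ)
    {u : RSpace n → RSpace n} (hu : Measurable u) {f g h : α → RSpace n} (hf : Measurable f)
    (hg : Measurable g) (hh : Measurable h) :
    Measurable fun q => slicingKernel p e u (f q) (g q) (h q) := by
  have hfgh : Measurable fun q => (f q, g q, h q) := hf.prodMk (hg.prodMk hh)
  have := (measurable_slicingKernel p e hu).comp hfgh
  simpa only [Function.comp_def] using this

/-- The inner integral of the triple integral in the slicing estimate. -/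
def slicingIntegral {n : ℕ} (Ω : Set (RSpace n)) (p e : ℝ) (u : RSpace n → RSpace n)
    (x y : RSpace n) : ℝ≥0∞ :=
  ∫⁻ z in Ω, slicingKernel p e u x y z

theorem measurable_slicingIntegral {n : ℕ} (Ω : Set (RSpace n)) (p e : ℝ)
    {u : RSpace n → RSpace n} (hu : Measurable u) :
    Measurable fun q : RSpace n × RSpace n => slicingIntegral Ω p e u q.1 q.2 := by
  have h := measurable_slicingKernel_comp (α := (RSpace n × RSpace n) × RSpace n) p e hu
    (f := fun q => q.1.1) (g := fun q => q.1.2) (h := fun q => q.2)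
    (by fun_prop) (by fun_prop) (by fun_prop)
  exact h.lintegral_prod_right'

/-- Move from x a distance |x - y|/4 towards the centre a, to c. The ball D of radius |x - y|/4
around c lies in B(a, r), and its points are within 2|x - y| of both x and y. Integrating |u(x) -
u(y)|^p ≤ 2^{p-1}(|u(x) - u(z)|^p + |u(y) - u(z)|^p) over z ∈ D gives the claim; the factor
multiplied on the left is |D|. -/
theorem rpow_mul_volume_le {n : ℕ} {p e : ℝ} (hp : 1 ≤ p) (u : RSpace n → RSpace n)
    {a x y : RSpace n} {r : ℝ} (hr : 0 < r) (hx : x ∈ sphere a r) (hy : y ∈ sphere a r)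
    (hxy : x ≠ y) {Ω : Set (RSpace n)} (hΩ : ball a r ⊆ Ω) (hu : Measurable u) :
    ‖u x - u y‖ₑ ^ p * ‖x - y‖ₑ ^ (-e) *
        (‖x - y‖ₑ ^ n * (ENNReal.ofReal (4⁻¹ ^ n) * volume (ball (0 : RSpace n) 1))) ≤
      2 ^ (p - 1) * (slicingIntegral Ω p e u x y + slicingIntegral Ω p e u y x) := by
  set t := ‖x - y‖ with ht
  have ht0 : 0 < t := norm_pos_iff.2 (sub_ne_zero.2 hxy)
  have hxa : ‖x - a‖ = r := mem_sphere_iff_norm.1 hx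
  have hya : ‖y - a‖ = r := mem_sphere_iff_norm.1 hy
  have ht2 : t ≤ 2 * r := by
    calc t = ‖(x - a) - (y - a)‖ := by rw [sub_sub_sub_cancel_right]
      _ ≤ 2 * r := by linarith [norm_sub_le (x - a) (y - a)]
  set c := x + (t / (4 * r)) • (a - x) with hc
  have hcx : ‖c - x‖ = t / 4 := by
    rw [hc, add_sub_cancel_left, norm_smul, norm_sub_rev a x, hxa,
      Real.norm_of_nonneg (by positivity)]
    field_simp
  have hca : ‖c - a‖ = r - t / 4 := by
    have h1 : c - a = (1 - t / (4 * r)) • (x - a) := by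
      rw [hc, sub_smul, one_smul, ← neg_sub x a, smul_neg]
      abel
    have h2 : 0 ≤ 1 - t / (4 * r) := by
      rw [sub_nonneg, div_le_one (by positivity)]
      linarith
    rw [h1, norm_smul, Real.norm_of_nonneg h2, hxa]
    field_simp
  set D := ball c (4⁻¹ * t) with hD
  have hDz : ∀ z ∈ D, ‖z - c‖ < t / 4 := fun z hz => by
    have := mem_ball_iff_norm.1 hz
    linarith
  have hDΩ : D ⊆ Ω := by
    refine Subset.trans (fun z hz => mem_ball_iff_norm.2 ?_) hΩ
    have := norm_sub_le_norm_sub_add_norm_sub z c a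
    linarith [hDz z hz]
  have hzx : ∀ z ∈ D, ‖x - z‖ ≤ 2 * ‖x - y‖ := fun z hz => by
    have := norm_sub_le_norm_sub_add_norm_sub z c x
    rw [norm_sub_rev x z]
    linarith [hDz z hz]
  have hzy : ∀ z ∈ D, ‖y - z‖ ≤ 2 * ‖y - x‖ := fun z hz => by
    have h1 := norm_sub_le_norm_sub_add_norm_sub z c x
    have h2 := norm_sub_le_norm_sub_add_norm_sub z x y
    rw [norm_sub_rev y z, norm_sub_rev y x]
    linarith [hDz z hz]
  have hvol : volume D =
      ‖x - y‖ₑ ^ n * (ENNReal.ofReal (4⁻¹ ^ n) * volume (ball (0 : RSpace n) 1)) := by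
    rw [hD, Measure.addHaar_ball_of_pos volume _ (by positivity), finrank_euclideanSpace,
      Fintype.card_fin, mul_pow, ENNReal.ofReal_mul (by positivity), ENNReal.ofReal_pow ht0.le,
      ht, ofReal_norm]
    ring
  have hm : ∀ w : RSpace n, Measurable fun z => ‖u w - u z‖ₑ ^ p * ‖x - y‖ₑ ^ (-e) :=
    fun w => by fun_prop
  rw [← hvol, ← setLIntegral_const]
  have hK : ∀ w v : RSpace n, ‖w - v‖ₑ = ‖x - y‖ₑ → (∀ z ∈ D, ‖w - z‖ ≤ 2 * ‖w - v‖) →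
      ∫⁻ z in D, ‖u w - u z‖ₑ ^ p * ‖x - y‖ₑ ^ (-e) ≤ slicingIntegral Ω p e u w v := by
    intro w v hwv hz
    refine le_trans (setLIntegral_mono' measurableSet_ball fun z hzD => ?_)
      (lintegral_mono_set hDΩ)
    have : (w, v, z) ∈ {q : RSpace n × RSpace n × RSpace n |
      ‖q.1 - q.2.2‖ ≤ 2 * ‖q.1 - q.2.1‖} := hz z hzD
    rw [slicingKernel, indicator_of_mem this, hwv]
  calc ∫⁻ _ in D, ‖u x - u y‖ₑ ^ p * ‖x - y‖ₑ ^ (-e)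
      ≤ ∫⁻ z in D, 2 ^ (p - 1) * (‖u x - u z‖ₑ ^ p * ‖x - y‖ₑ ^ (-e) +
          ‖u y - u z‖ₑ ^ p * ‖x - y‖ₑ ^ (-e)) := by
        refine lintegral_mono fun z => ?_
        rw [← add_mul, ← mul_assoc]
        refine mul_le_mul_left ?_ _
        refine le_trans ?_ (ENNReal.rpow_add_le_mul_rpow_add_rpow _ _ hp)
        refine ENNReal.rpow_le_rpow ?_ (by linarith)
        rw [← enorm_neg (u y - u z), neg_sub]
        refine le_trans (le_of_eq ?_) (enorm_add_le _ _)
        rw [sub_add_sub_cancel]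
    _ = 2 ^ (p - 1) * ((∫⁻ z in D, ‖u x - u z‖ₑ ^ p * ‖x - y‖ₑ ^ (-e)) +
          ∫⁻ z in D, ‖u y - u z‖ₑ ^ p * ‖x - y‖ₑ ^ (-e)) := by
        rw [← lintegral_add_left (hm x)]
        exact lintegral_const_mul _ ((hm x).add (hm y))
    _ ≤ _ := by
        refine mul_le_mul_right (add_le_add (hK x y rfl hzx) (hK y x ?_ hzy)) _
        rw [← enorm_neg, neg_sub]

/-- The Gagliardo seminorm on a sphere is controlled by the integral over the sphere of the
Gagliardo density of the ball. -/
theorem exists_gagliardoPow_sphere_le {n : ℕ} (hn : n ≠ 0) {s p : ℝ} (hs : 0 < s) (hp : 1 < p)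
    (a : RSpace n) {r : ℝ} (hr : 0 < r) (σ : Measure (RSpace n)) [IsFiniteMeasure σ]
    (hσs : ∀ᵐ x ∂σ, x ∈ sphere a r) {C : ℝ≥0∞} (hC : C ≠ ∞)
    (hσ : ∀ x ∈ sphere a r, ∀ ρ : ℝ, 0 < ρ → σ (ball x ρ) ≤ C * ENNReal.ofReal ρ ^ (n - 1))
    {Ω : Set (RSpace n)} (hΩ : ball a r ⊆ Ω) :
    ∃ K : ℝ≥0∞, K ≠ ∞ ∧ ∀ u : RSpace n → RSpace n, Measurable u →
      gagliardoPow ((n : ℝ) - 1) s p σ u ≤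
        K * ∫⁻ x, gagliardoDensity n s p (volume.restrict Ω) u x ∂σ := by
  have hp0 : 0 < p := by linarith
  have hn1 : (1 : ℝ) ≤ n := by exact_mod_cast Nat.one_le_iff_ne_zero.2 hn
  set b : ℝ := n + s * p with hb
  have hb1 : 1 ≤ b := by nlinarith [mul_pos hs hp0]
  -- The exponent is that of the sphere seminorm, n - 1 + sp, plus n to compensate for |D|, which is
  -- proportional to |x - y|^n.
  set e : ℝ := (n - 1 : ℕ) + b with he
  have hnc : ((n - 1 : ℕ) : ℝ) = n - 1 := by
    rw [Nat.cast_sub (Nat.one_le_iff_ne_zero.2 hn), Nat.cast_one]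
  set κ : ℝ≥0∞ := ENNReal.ofReal (4⁻¹ ^ n) * volume (ball (0 : RSpace n) 1) with hκ
  have hκ0 : κ ≠ 0 := mul_ne_zero (ENNReal.ofReal_pos.2 (by positivity)).ne'
    (measure_ball_pos _ _ one_pos).ne'
  have hκt : κ ≠ ∞ := ENNReal.mul_ne_top ENNReal.ofReal_ne_top measure_ball_lt_top.ne
  have h2p : (2 : ℝ≥0∞) ^ (p - 1) ≠ ∞ :=
    ENNReal.rpow_ne_top_of_nonneg (by linarith) (by norm_num)
  set K₁ : ℝ≥0∞ := C * 2 ^ (n - 1) * 2 * ENNReal.ofReal 2⁻¹ ^ (-b) with hK₁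
  have hK₁t : K₁ ≠ ∞ := by
    refine ENNReal.mul_ne_top (by finiteness) ?_
    rw [ENNReal.ofReal_rpow_of_pos (by norm_num)]
    exact ENNReal.ofReal_ne_top
  -- The factor 2^{p-1} comes from convexity, κ is the volume of D divided by |x - y|^n, and the two
  -- copies of K₁ are the terms exchanged by x ↔ y.
  refine ⟨2 ^ (p - 1) / κ * (K₁ + K₁), by finiteness, fun u hu => ?_⟩
  set I := ∫⁻ x, gagliardoDensity n s p (volume.restrict Ω) u x ∂σ with hI
  have hΦ2 := measurable_slicingIntegral Ω p e hu
  -- For fixed x and z the integration in y runs over |x - y| ≥ |x - z|/2. Since caps have dimension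
  -- n - 1, integrating |x - y|^{-(n-1+b)} there gives a multiple of |x - z|^{-b}, the Gagliardo
  -- weight of dimension n.
  have hmain : ∫⁻ x, ∫⁻ y, slicingIntegral Ω p e u x y ∂σ ∂σ ≤ K₁ * I := by
    rw [hI, ← lintegral_const_mul' _ _ hK₁t]
    refine lintegral_mono_ae ?_
    filter_upwards [hσs] with x hx
    have hm := measurable_slicingKernel_comp (α := RSpace n × RSpace n) p e hu
      (f := fun _ => x) (g := fun q => q.1) (h := fun q => q.2)
      (by fun_prop) (by fun_prop) (by fun_prop)
    simp only [slicingIntegral]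
    rw [lintegral_lintegral_swap (f := fun y z => slicingKernel p e u x y z) hm.aemeasurable,
      gagliardoDensity, ← lintegral_const_mul' _ _ hK₁t]
    refine lintegral_mono fun z => ?_
    by_cases hxz : x = z
    · refine le_of_eq_of_le ?_ zero_le
      rw [← lintegral_zero (μ := σ)]
      refine lintegral_congr fun y => ?_
      simp [slicingKernel, hxz, hp0]
    have hpos : 0 < ‖x - z‖ := norm_pos_iff.2 (sub_ne_zero.2 hxz)
    have hset : MeasurableSet {y | 2⁻¹ * ‖x - z‖ ≤ ‖x - y‖} :=
      measurableSet_le measurable_const (by fun_prop)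
    calc ∫⁻ y, slicingKernel p e u x y z ∂σ
        = ∫⁻ y in {y | 2⁻¹ * ‖x - z‖ ≤ ‖x - y‖}, ‖u x - u z‖ₑ ^ p * ‖x - y‖ₑ ^ (-e) ∂σ := by
          rw [← lintegral_indicator hset]
          refine lintegral_congr fun y => ?_
          have hiff : ((x, y, z) ∈ {q : RSpace n × RSpace n × RSpace n |
              ‖q.1 - q.2.2‖ ≤ 2 * ‖q.1 - q.2.1‖}) ↔ y ∈ {y | 2⁻¹ * ‖x - z‖ ≤ ‖x - y‖} := by
            simp only [mem_ofPred_eq]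
            constructor <;> intro h <;> linarith
          by_cases h : y ∈ {y | 2⁻¹ * ‖x - z‖ ≤ ‖x - y‖}
          · rw [slicingKernel, indicator_of_mem (hiff.2 h), indicator_of_mem h]
          · rw [slicingKernel, indicator_of_notMem (fun h' => h (hiff.1 h')),
              indicator_of_notMem h]
      _ = ‖u x - u z‖ₑ ^ p *
            ∫⁻ y in {y | 2⁻¹ * ‖x - z‖ ≤ ‖x - y‖}, ‖x - y‖ₑ ^ (-e) ∂σ :=
          lintegral_const_mul _ (by fun_prop)
      _ ≤ ‖u x - u z‖ₑ ^ p *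
            (C * 2 ^ (n - 1) * 2 * ENNReal.ofReal (2⁻¹ * ‖x - z‖) ^ (-b)) :=
          mul_le_mul_right (lintegral_enorm_rpow_neg_le σ x (hσ x hx) hb1 (by positivity)) _
      _ = K₁ * (‖u x - u z‖ₑ ^ p / ‖x - z‖ₑ ^ b) := by
          rw [ENNReal.ofReal_mul (by norm_num), ENNReal.mul_rpow_of_ne_top
            ENNReal.ofReal_ne_top ENNReal.ofReal_ne_top, ofReal_norm, ENNReal.rpow_neg ‖x - z‖ₑ,
            hK₁, div_eq_mul_inv]
          ring
  calc gagliardoPow ((n : ℝ) - 1) s p σ u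
      ≤ ∫⁻ x, ∫⁻ y, 2 ^ (p - 1) / κ * (slicingIntegral Ω p e u x y +
          slicingIntegral Ω p e u y x) ∂σ ∂σ := by
        refine lintegral_mono_ae ?_
        filter_upwards [hσs] with x hx
        refine lintegral_mono_ae ?_
        filter_upwards [hσs] with y hy
        by_cases hxy : x = y
        · simp [hxy, hp0]
        have h := rpow_mul_volume_le (e := e) hp.le u hr hx hy hxy hΩ hu
        have ht0 : ‖x - y‖ₑ ≠ 0 := enorm_ne_zero.2 (sub_ne_zero.2 hxy)
        have heq : ‖x - y‖ₑ ^ (-e) * ‖x - y‖ₑ ^ n = (‖x - y‖ₑ ^ ((n : ℝ) - 1 + s * p))⁻¹ := by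
          rw [← ENNReal.rpow_natCast, ← ENNReal.rpow_add _ _ ht0 enorm_ne_top,
            ← ENNReal.rpow_neg, he, hnc, hb]
          congr 1
          ring
        rw [← ENNReal.mul_div_right_comm, ENNReal.le_div_iff_mul_le (Or.inl hκ0) (Or.inl hκt)]
        refine le_trans (le_of_eq ?_) h
        rw [div_eq_mul_inv, ← heq]
        ring
    _ = 2 ^ (p - 1) / κ * (∫⁻ x, ∫⁻ y, slicingIntegral Ω p e u x y ∂σ ∂σ +
          ∫⁻ x, ∫⁻ y, slicingIntegral Ω p e u y x ∂σ ∂σ) := by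
        have hc : 2 ^ (p - 1) / κ ≠ ∞ := ENNReal.div_ne_top h2p hκ0
        simp_rw [lintegral_const_mul' _ _ hc]
        rw [← lintegral_add_left hΦ2.lintegral_prod_right']
        congr 1
        refine lintegral_congr fun x => ?_
        exact lintegral_add_left
          (hΦ2.comp (by fun_prop : Measurable fun y : RSpace n => (x, y))) _
    _ ≤ 2 ^ (p - 1) / κ * (K₁ * I + K₁ * I) := by
        refine mul_le_mul_right (add_le_add hmain (le_trans (le_of_eq ?_) hmain)) _
        exact lintegral_lintegral_swap (hΦ2.comp measurable_swap).aemeasurable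
    _ = _ := by rw [← add_mul, mul_assoc]

/-! ### Averages, fractional Poincaré inequality and strong L^p convergence -/

theorem enorm_integral_sub_rpow_le {α E : Type*} [MeasurableSpace α] [NormedAddCommGroup E]
    [NormedSpace ℝ E] [CompleteSpace E] {m : Measure α} [IsProbabilityMeasure m] {p : ℝ}
    (hp : 1 ≤ p) {f : α → E} (hf : Integrable f m) (c : E) :
    ‖(∫ x, f x ∂m) - c‖ₑ ^ p ≤ ∫⁻ x, ‖f x - c‖ₑ ^ p ∂m := by
  have hp0 : 0 < p := by linarith
  have h1 : (∫ x, f x ∂m) - c = ∫ x, (f x - c) ∂m := by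
    rw [integral_sub hf (integrable_const c), integral_const]
    simp
  have h2 : ‖(∫ x, f x ∂m) - c‖ₑ ≤ (∫⁻ x, ‖f x - c‖ₑ ^ p ∂m) ^ (1 / p) := by
    rw [h1]
    refine (enorm_integral_le_lintegral_enorm _).trans ?_
    rw [← eLpNorm_one_eq_lintegral_enorm, ← eLpNorm_eq_lintegral_ofReal hp]
    exact eLpNorm_le_eLpNorm_of_exponent_le (by simpa using hp)
      (hf.aestronglyMeasurable.sub aestronglyMeasurable_const)
  have h3 := ENNReal.rpow_le_rpow h2 hp0.le
  rwa [one_div, ENNReal.rpow_inv_rpow hp0.ne'] at h3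

theorem enorm_average_sub_rpow_le {α E : Type*} [MeasurableSpace α] [NormedAddCommGroup E]
    [NormedSpace ℝ E] [CompleteSpace E] {μ : Measure α} {p : ℝ} (hp : 1 ≤ p) {B : Set α}
    (hB0 : μ B ≠ 0) (hB : μ B ≠ ∞) {f : α → E} (hf : IntegrableOn f B μ) (c : E) :
    ‖(⨍ x in B, f x ∂μ) - c‖ₑ ^ p ≤ (μ B)⁻¹ * ∫⁻ x in B, ‖f x - c‖ₑ ^ p ∂μ := by
  have : IsFiniteMeasure (μ.restrict B) := ⟨by simpa using hB.lt_top⟩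
  have : NeZero (μ.restrict B) := ⟨by simpa using hB0⟩
  have h := enorm_integral_sub_rpow_le (m := ((μ.restrict B) univ)⁻¹ • μ.restrict B) hp
    (hf.smul_measure (by simpa using hB0)) c
  rw [lintegral_smul_measure, Measure.restrict_apply_univ] at h
  rw [average, Measure.restrict_apply_univ]
  exact h

section Averages

variable {n : ℕ} {s p : ℝ} {Ω : Set (RSpace n)} {g : RSpace n → RSpace n}

theorem integrableOn_ball_of_memLp (hp : 1 ≤ p)
    (hg : MemLp g (ENNReal.ofReal p) (volume.restrict Ω)) {x : RSpace n} {ρ : ℝ}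
    (hx : ball x ρ ⊆ Ω) : IntegrableOn g (ball x ρ) := by
  have : IsFiniteMeasure (volume.restrict (ball x ρ)) :=
    ⟨by simpa using measure_ball_lt_top⟩
  exact (hg.mono_measure (Measure.restrict_mono hx le_rfl)).integrable (by simpa using hp)

theorem volume_ball_eq (x : RSpace n) {ρ : ℝ} (hρ : 0 < ρ) :
    volume (ball x ρ) = ENNReal.ofReal ρ ^ n * volume (ball (0 : RSpace n) 1) := by
  rw [Measure.addHaar_ball_of_pos volume _ hρ, finrank_euclideanSpace, Fintype.card_fin,
    ENNReal.ofReal_pow hρ.le]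

/-- The constant in the fractional Poincaré inequality. -/
def poincareConst (n : ℕ) (b : ℝ) : ℝ≥0∞ :=
  (volume (ball (0 : RSpace n) 1))⁻¹ * 2 ^ b

theorem poincareConst_ne_top (n : ℕ) {b : ℝ} (hb : 0 ≤ b) : poincareConst n b ≠ ∞ :=
  ENNReal.mul_ne_top (ENNReal.inv_ne_top.2 (measure_ball_pos _ _ one_pos).ne')
    (ENNReal.rpow_ne_top_of_nonneg hb (by norm_num))

/-- Fractional Poincaré inequality: the average over a ball against the value at a point of the
ball. -/
theorem enorm_average_ball_sub_rpow_le (hs : 0 ≤ s) (hp : 1 ≤ p)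
    (hg : MemLp g (ENNReal.ofReal p) (volume.restrict Ω)) {x y : RSpace n} {ρ : ℝ} (hρ : 0 < ρ)
    (hx : ball x ρ ⊆ Ω) (hy : y ∈ ball x ρ) :
    ‖(⨍ z in ball x ρ, g z) - g y‖ₑ ^ p ≤ poincareConst n (n + s * p) *
      ENNReal.ofReal ρ ^ (s * p) * gagliardoDensity n s p (volume.restrict Ω) g y := by
  have hp0 : 0 < p := by linarith
  set b : ℝ := n + s * p with hb
  have hb0 : 0 ≤ b := by positivity
  set t := ENNReal.ofReal ρ with ht
  have ht0 : t ≠ 0 := (ENNReal.ofReal_pos.2 hρ).ne'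
  have htt : t ≠ ∞ := ENNReal.ofReal_ne_top
  have hV0 : volume (ball (0 : RSpace n) 1) ≠ 0 := (measure_ball_pos _ _ one_pos).ne'
  have hVt : volume (ball (0 : RSpace n) 1) ≠ ∞ := measure_ball_lt_top.ne
  refine (enorm_average_sub_rpow_le hp (measure_ball_pos _ _ hρ).ne' measure_ball_lt_top.ne
    (integrableOn_ball_of_memLp hp hg hx) (g y)).trans ?_
  -- Two points of the ball are at distance less than 2ρ, so inserting the weight (2ρ)^b / |y - z|^b
  -- only increases the integral.
  have h1 : ∫⁻ z in ball x ρ, ‖g z - g y‖ₑ ^ p ≤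
      (2 * t) ^ b * gagliardoDensity n s p (volume.restrict Ω) g y := by
    have hc : (2 * t) ^ b ≠ ∞ := ENNReal.rpow_ne_top_of_nonneg hb0 (by finiteness)
    rw [gagliardoDensity, ← lintegral_const_mul' _ _ hc]
    refine le_trans (setLIntegral_mono' measurableSet_ball fun z hz => ?_) (lintegral_mono_set hx)
    by_cases hyz : y = z
    · simp [hyz, hp0]
    rw [← enorm_neg (g z - g y), neg_sub, ← mul_div_assoc, mul_comm]
    have h0 : ‖y - z‖ₑ ^ b ≠ 0 := by
      rw [ne_eq, ENNReal.rpow_eq_zero_iff]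
      simp [sub_ne_zero.2 hyz]
    rw [ENNReal.le_div_iff_mul_le (Or.inl h0)
      (Or.inl (ENNReal.rpow_ne_top_of_nonneg hb0 enorm_ne_top))]
    refine mul_le_mul_right (ENNReal.rpow_le_rpow ?_ hb0) _
    have e : (2 : ℝ≥0∞) * ENNReal.ofReal ρ = ENNReal.ofReal (2 * ρ) := by
      rw [ENNReal.ofReal_mul (by norm_num), ENNReal.ofReal_ofNat]
    rw [← ofReal_norm, ht, e]
    refine ENNReal.ofReal_le_ofReal ?_
    rw [← dist_eq_norm]
    linarith [dist_triangle_right y z x, mem_ball.1 hz, mem_ball.1 hy]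
  refine (mul_le_mul_right h1 _).trans (le_of_eq ?_)
  rw [volume_ball_eq x hρ, poincareConst, ENNReal.mul_rpow_of_nonneg _ _ hb0,
    ENNReal.mul_inv (Or.inr hVt) (Or.inr hV0)]
  have h2 : t ^ b = t ^ n * t ^ (s * p) := by
    rw [← ENNReal.rpow_natCast, ← ENNReal.rpow_add _ _ ht0 htt]
  rw [h2]
  have h3 : (t ^ n)⁻¹ * t ^ n = 1 :=
    ENNReal.inv_mul_cancel (pow_ne_zero _ ht0) (ENNReal.pow_ne_top htt)
  calc _ = ((t ^ n)⁻¹ * t ^ n) * ((volume (ball (0 : RSpace n) 1))⁻¹ * 2 ^ b * t ^ (s * p) *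
        gagliardoDensity n s p (volume.restrict Ω) g y) := by ring
    _ = _ := by rw [h3, one_mul]

/-- The volume of a ball does not depend on its centre, so the average is a constant times a
parametric integral of a jointly measurable function. -/
theorem measurable_average_ball (hg : Measurable g) (ρ : ℝ) :
    Measurable fun x => ⨍ z in ball x ρ, g z := by
  have hm : MeasurableSet {q : RSpace n × RSpace n | dist q.2 q.1 < ρ} :=
    measurableSet_lt (measurable_snd.dist measurable_fst) measurable_const
  have h1 : ∀ x : RSpace n, (⨍ z in ball x ρ, g z) = (volume.real (ball (0 : RSpace n) ρ))⁻¹ •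
      ∫ z, {q : RSpace n × RSpace n | dist q.2 q.1 < ρ}.indicator (fun q => g q.2) (x, z) := by
    intro x
    rw [setAverage_eq, ← integral_indicator (measurableSet_ball (x := x) (ε := ρ))]
    congr 2
    rw [Measure.real, Measure.real, Measure.addHaar_ball_center]
  simp_rw [h1]
  have h2 : StronglyMeasurable ({q : RSpace n × RSpace n | dist q.2 q.1 < ρ}.indicator
      (fun q => g q.2)) := (hg.comp measurable_snd).stronglyMeasurable.indicator hm
  exact h2.integral_prod_right'.measurable.const_smul (volume.real (ball (0 : RSpace n) ρ))⁻¹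

/-- Averages that converge at every point of a ball, for a bounded sequence of `W^{s,p}`: the
sequence converges in `L^p` of the smaller concentric balls. -/
theorem tendsto_lintegral_sub_of_average (hs : 0 < s) (hp : 1 < p) {f : ℕ → RSpace n → RSpace n}
    (hf : ∀ k, Measurable (f k)) (hg : Measurable g)
    (hfL : ∀ k, MemLp (f k) (ENNReal.ofReal p) (volume.restrict Ω))
    (hgL : MemLp g (ENNReal.ofReal p) (volume.restrict Ω)) {M : ℝ≥0∞} (hM : M ≠ ∞)
    (hfM : ∀ k, ∫⁻ x in Ω, ‖f k x‖ₑ ^ p + gagliardoDensity n s p (volume.restrict Ω) (f k) x ≤ M)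
    (hgM : ∫⁻ x in Ω, gagliardoDensity n s p (volume.restrict Ω) g x ≤ M)
    (hav : ∀ x ρ, 0 < ρ → ball x ρ ⊆ Ω →
      Tendsto (fun k => ⨍ z in ball x ρ, f k z) atTop (𝓝 (⨍ z in ball x ρ, g z)))
    {a : RSpace n} {R R' : ℝ} (hR : ball a R ⊆ Ω) (hRR : R' < R) :
    Tendsto (fun k => ∫⁻ x in ball a R', ‖f k x - g x‖ₑ ^ p) atTop (𝓝 0) := by
  have hp0 : 0 < p := by linarith
  have hR'Ω : ball a R' ⊆ Ω := (ball_subset_ball hRR.le).trans hR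
  set P := poincareConst n (n + s * p) with hP
  have hPt : P ≠ ∞ := poincareConst_ne_top n (by positivity)
  have h2p : (2 : ℝ≥0∞) ^ (p - 1) ≠ ∞ :=
    ENNReal.rpow_ne_top_of_nonneg (by linarith) (by norm_num)
  have hball : ∀ ρ, ρ ≤ R - R' → ∀ x ∈ ball a R', ball x ρ ⊆ Ω := fun ρ hρ x hx =>
    (ball_subset_ball' (by linarith [mem_ball.1 hx])).trans hR
  have hden : ∀ u : RSpace n → RSpace n, MemLp u (ENNReal.ofReal p) (volume.restrict Ω) →
      (∫⁻ x in Ω, gagliardoDensity n s p (volume.restrict Ω) u x ≤ M) → ∀ ρ, 0 < ρ →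
      ρ ≤ R - R' → ∫⁻ x in ball a R', ‖(⨍ z in ball x ρ, u z) - u x‖ₑ ^ p ≤
        P * ENNReal.ofReal ρ ^ (s * p) * M := by
    intro u hu huM ρ hρ hρR
    have hc : P * ENNReal.ofReal ρ ^ (s * p) ≠ ∞ := ENNReal.mul_ne_top hPt
      (ENNReal.rpow_ne_top_of_nonneg (by positivity) ENNReal.ofReal_ne_top)
    calc _ ≤ ∫⁻ x in ball a R', P * ENNReal.ofReal ρ ^ (s * p) *
          gagliardoDensity n s p (volume.restrict Ω) u x :=
          setLIntegral_mono' measurableSet_ball fun x hx =>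
            enorm_average_ball_sub_rpow_le hs.le hp.le hu hρ (hball ρ hρR x hx)
              (mem_ball_self hρ)
      _ ≤ ∫⁻ x in Ω, P * ENNReal.ofReal ρ ^ (s * p) *
          gagliardoDensity n s p (volume.restrict Ω) u x := lintegral_mono_set hR'Ω
      _ ≤ _ := by
          rw [lintegral_const_mul' _ _ hc]
          exact mul_le_mul_right huM _
  -- At a fixed scale the averages converge pointwise and, by Jensen and the L^p bounds, are
  -- dominated by a constant on the bounded ball.
  have hmid : ∀ ρ, 0 < ρ → ρ ≤ R - R' → Tendsto (fun k => ∫⁻ x in ball a R',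
      ‖(⨍ z in ball x ρ, f k z) - ⨍ z in ball x ρ, g z‖ₑ ^ p) atTop (𝓝 0) := by
    intro ρ hρ hρR
    set V := volume (ball (0 : RSpace n) ρ) with hV
    have hV0 : V ≠ 0 := (measure_ball_pos _ _ hρ).ne'
    have hVx : ∀ x : RSpace n, volume (ball x ρ) = V := fun x => Measure.addHaar_ball_center _ _ _
    have hgn : ∫⁻ x in Ω, ‖g x‖ₑ ^ p ≠ ∞ := ((memLp_ofReal_iff hp.le hgL.1).1 hgL).ne
    have hbd : ∀ u : RSpace n → RSpace n, MemLp u (ENNReal.ofReal p) (volume.restrict Ω) →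
        ∀ x ∈ ball a R', ‖⨍ z in ball x ρ, u z‖ₑ ^ p ≤ V⁻¹ * ∫⁻ x in Ω, ‖u x‖ₑ ^ p := by
      intro u hu x hx
      have h := enorm_average_sub_rpow_le hp.le (measure_ball_pos volume x hρ).ne'
        measure_ball_lt_top.ne (integrableOn_ball_of_memLp hp.le hu (hball ρ hρR x hx)) 0
      simp only [sub_zero, hVx] at h
      exact h.trans (mul_le_mul_right (lintegral_mono_set (hball ρ hρR x hx)) _)
    have hzero : ∫⁻ x in ball a R', (0 : ℝ≥0∞) = 0 := lintegral_zero
    rw [← hzero]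
    refine tendsto_lintegral_of_dominated_convergence
      (fun _ => 2 ^ (p - 1) * (V⁻¹ * M + V⁻¹ * ∫⁻ x in Ω, ‖g x‖ₑ ^ p)) (fun k => ?_) (fun k => ?_)
      ?_ ?_
    · exact ((measurable_average_ball (hf k) ρ).sub
        (measurable_average_ball hg ρ)).enorm.pow_const p
    · refine (ae_restrict_iff' measurableSet_ball).2 (ae_of_all _ fun x hx => ?_)
      refine (ENNReal.rpow_le_rpow enorm_sub_le hp0.le).trans
        ((ENNReal.rpow_add_le_mul_rpow_add_rpow _ _ hp.le).trans ?_)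
      refine mul_le_mul_right (add_le_add ((hbd _ (hfL k) x hx).trans ?_) (hbd _ hgL x hx)) _
      refine mul_le_mul_right (le_trans ?_ (hfM k)) _
      exact lintegral_mono fun z => le_self_add
    · rw [lintegral_const, Measure.restrict_apply_univ]
      have := ENNReal.inv_ne_top.2 hV0
      have := (measure_ball_lt_top (μ := (volume : Measure (RSpace n))) (x := a) (r := R')).ne
      finiteness
    · refine (ae_restrict_iff' measurableSet_ball).2 (ae_of_all _ fun x hx => ?_)
      have h0 := (hav x ρ hρ (hball ρ hρR x hx)).sub_const (⨍ z in ball x ρ, g z)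
      have h1 := (h0.enorm).ennrpow_const p
      simpa [hp0] using h1
  -- Both differences between a function and its averages are O(ρ^{sp}) uniformly in k. So ρ is
  -- fixed first, and then k tends to infinity.
  have hsplit : ∀ k ρ, 0 < ρ → ρ ≤ R - R' → ∫⁻ x in ball a R', ‖f k x - g x‖ₑ ^ p ≤
      2 ^ (p - 1) * (P * ENNReal.ofReal ρ ^ (s * p) * M + 2 ^ (p - 1) *
        ((∫⁻ x in ball a R', ‖(⨍ z in ball x ρ, f k z) - ⨍ z in ball x ρ, g z‖ₑ ^ p) +
          P * ENNReal.ofReal ρ ^ (s * p) * M)) := by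
    intro k ρ hρ hρR
    have hm1 : Measurable fun x => ‖(⨍ z in ball x ρ, f k z) - f k x‖ₑ ^ p :=
      ((measurable_average_ball (hf k) ρ).sub (hf k)).enorm.pow_const p
    have hm2 : Measurable fun x => ‖(⨍ z in ball x ρ, f k z) - ⨍ z in ball x ρ, g z‖ₑ ^ p :=
      ((measurable_average_ball (hf k) ρ).sub (measurable_average_ball hg ρ)).enorm.pow_const p
    calc _ ≤ ∫⁻ x in ball a R', 2 ^ (p - 1) * (‖(⨍ z in ball x ρ, f k z) - f k x‖ₑ ^ p +
          2 ^ (p - 1) * (‖(⨍ z in ball x ρ, f k z) - ⨍ z in ball x ρ, g z‖ₑ ^ p +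
            ‖(⨍ z in ball x ρ, g z) - g x‖ₑ ^ p)) := by
          refine lintegral_mono fun x => ?_
          have e1 : f k x - g x = -((⨍ z in ball x ρ, f k z) - f k x) +
            (((⨍ z in ball x ρ, f k z) - ⨍ z in ball x ρ, g z) +
              ((⨍ z in ball x ρ, g z) - g x)) := by abel
          rw [e1]
          refine (ENNReal.rpow_le_rpow (enorm_add_le _ _) hp0.le).trans
            ((ENNReal.rpow_add_le_mul_rpow_add_rpow _ _ hp.le).trans ?_)
          rw [enorm_neg]
          refine mul_le_mul_right (add_le_add_right ?_ _) _
          exact (ENNReal.rpow_le_rpow (enorm_add_le _ _) hp0.le).trans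
            (ENNReal.rpow_add_le_mul_rpow_add_rpow _ _ hp.le)
      _ = 2 ^ (p - 1) * ((∫⁻ x in ball a R', ‖(⨍ z in ball x ρ, f k z) - f k x‖ₑ ^ p) +
          2 ^ (p - 1) * ((∫⁻ x in ball a R',
            ‖(⨍ z in ball x ρ, f k z) - ⨍ z in ball x ρ, g z‖ₑ ^ p) +
            ∫⁻ x in ball a R', ‖(⨍ z in ball x ρ, g z) - g x‖ₑ ^ p)) := by
          rw [lintegral_const_mul' _ _ h2p, lintegral_add_left hm1, lintegral_const_mul' _ _ h2p,
            lintegral_add_left hm2]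
      _ ≤ _ := by
          refine mul_le_mul_right (add_le_add (hden _ (hfL k) ?_ ρ hρ hρR)
            (mul_le_mul_right (add_le_add_right (hden g hgL hgM ρ hρ hρR) _) _)) _
          exact le_trans (lintegral_mono fun x => le_add_self) (hfM k)
  have hlim : Tendsto (fun ρ : ℝ => 2 ^ (p - 1) * (P * ENNReal.ofReal ρ ^ (s * p) * M +
      2 ^ (p - 1) * (0 + P * ENNReal.ofReal ρ ^ (s * p) * M))) (𝓝[>] 0) (𝓝 0) := by
    have h0 : Tendsto (fun ρ : ℝ => ENNReal.ofReal ρ ^ (s * p)) (𝓝[>] 0) (𝓝 0) := by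
      have h := (ENNReal.continuous_ofReal.tendsto (0 : ℝ)).ennrpow_const (s * p)
      rw [ENNReal.ofReal_zero, ENNReal.zero_rpow_of_pos (by positivity)] at h
      exact h.mono_left nhdsWithin_le_nhds
    have h1 : Tendsto (fun ρ : ℝ => P * ENNReal.ofReal ρ ^ (s * p) * M) (𝓝[>] 0) (𝓝 0) := by
      have := ENNReal.Tendsto.mul_const (ENNReal.Tendsto.const_mul h0 (Or.inr hPt))
        (Or.inr hM)
      simpa using this
    have h2 := ENNReal.Tendsto.const_mul (h1.add (ENNReal.Tendsto.const_mul
      ((tendsto_const_nhds (x := (0 : ℝ≥0∞))).add h1) (Or.inr h2p))) (Or.inr h2p)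
    simpa using h2
  refine ENNReal.tendsto_nhds_zero.2 fun ε hε => ?_
  obtain ⟨ρ, hρε, hρ0, hρR⟩ := ((hlim.eventually_lt_const hε).and
    (Ioo_mem_nhdsGT (sub_pos.2 hRR))).exists
  have h3 : Tendsto (fun k => 2 ^ (p - 1) * (P * ENNReal.ofReal ρ ^ (s * p) * M + 2 ^ (p - 1) *
      ((∫⁻ x in ball a R', ‖(⨍ z in ball x ρ, f k z) - ⨍ z in ball x ρ, g z‖ₑ ^ p) +
        P * ENNReal.ofReal ρ ^ (s * p) * M))) atTop
      (𝓝 (2 ^ (p - 1) * (P * ENNReal.ofReal ρ ^ (s * p) * M +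
        2 ^ (p - 1) * (0 + P * ENNReal.ofReal ρ ^ (s * p) * M)))) :=
    ENNReal.Tendsto.const_mul (tendsto_const_nhds.add (ENNReal.Tendsto.const_mul
      ((hmid ρ hρ0 hρR.le).add tendsto_const_nhds) (Or.inr h2p))) (Or.inr h2p)
  filter_upwards [h3.eventually_lt_const hρε] with k hk
  exact (hsplit k ρ hρ0 hρR.le).trans hk.le

end Averages

/-! ### Convergence of averages at every point of a sphere when sp > n - 1 -/

/-- A function of `ρ > 0` whose oscillation over `[ρ / 2, ρ]` is `O(ρ ^ α)` has a limit at zero,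
with the same rate. -/
theorem exists_tendsto_of_dyadic_le {E : Type*} [NormedAddCommGroup E] [CompleteSpace E]
    {A : ℝ → E} {K α ρ₀ : ℝ} (hK : 0 ≤ K) (hα : 0 < α) (hρ₀ : 0 < ρ₀)
    (h : ∀ ρ τ, 0 < τ → ρ / 2 ≤ τ → τ ≤ ρ → ρ ≤ ρ₀ → ‖A ρ - A τ‖ ≤ K * ρ ^ α) :
    ∃ L, Tendsto A (𝓝[>] 0) (𝓝 L) ∧
      ∀ ρ, 0 < ρ → ρ ≤ ρ₀ → ‖A ρ - L‖ ≤ K / (1 - 2⁻¹ ^ α) * ρ ^ α := by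
  set q : ℝ := 2⁻¹ ^ α with hq
  have hq1 : q < 1 := Real.rpow_lt_one (by norm_num) (by norm_num) hα
  have hq0 : 0 < q := by positivity
  set C := K / (1 - q) with hC
  have hC0 : 0 ≤ C := div_nonneg hK (by linarith)
  -- C is the sum of the geometric series with first term K and ratio q = 2^{-α}; this identity
  -- closes the induction on the number of halvings.
  have hKC : K + C * q = C := by
    have h1q : 1 - q ≠ 0 := by linarith
    rw [hC]
    field_simp
    ring
  have hKleC : K ≤ C := by nlinarith
  have hstep : ∀ j : ℕ, ∀ ρ τ, 0 < τ → ρ ≤ 2 ^ j * τ → τ ≤ ρ → ρ ≤ ρ₀ →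
      ‖A ρ - A τ‖ ≤ C * ρ ^ α := by
    intro j
    induction j with
    | zero =>
      intro ρ τ hτ h1 h2 h3
      have hρ : 0 < ρ := hτ.trans_le h2
      refine (h ρ τ hτ ?_ h2 h3).trans (by gcongr)
      rw [pow_zero, one_mul] at h1
      linarith
    | succ j ih =>
      intro ρ τ hτ h1 h2 h3
      have hρ : 0 < ρ := hτ.trans_le h2
      rcases le_total (ρ / 2) τ with h4 | h4
      · exact (h ρ τ hτ h4 h2 h3).trans (by gcongr)
      · have h5 := h ρ (ρ / 2) (by positivity) le_rfl (by linarith) h3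
        have h6 := ih (ρ / 2) τ hτ (by rw [pow_succ] at h1; linarith) h4 (by linarith)
        have h7 : (ρ / 2) ^ α = q * ρ ^ α := by
          rw [div_eq_inv_mul, Real.mul_rpow (by norm_num) hρ.le]
        calc ‖A ρ - A τ‖ ≤ ‖A ρ - A (ρ / 2)‖ + ‖A (ρ / 2) - A τ‖ :=
              norm_sub_le_norm_sub_add_norm_sub _ _ _
          _ ≤ K * ρ ^ α + C * (q * ρ ^ α) := by rw [h7] at h6; exact add_le_add h5 h6
          _ = (K + C * q) * ρ ^ α := by ring
          _ = C * ρ ^ α := by rw [hKC]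
  have hall : ∀ ρ τ, 0 < τ → τ ≤ ρ → ρ ≤ ρ₀ → ‖A ρ - A τ‖ ≤ C * ρ ^ α := by
    intro ρ τ hτ h2 h3
    obtain ⟨j, hj⟩ := pow_unbounded_of_one_lt (ρ / τ) (one_lt_two (α := ℝ))
    exact hstep j ρ τ hτ ((div_le_iff₀ hτ).1 hj.le) h2 h3
  have hrpow : Tendsto (fun ρ : ℝ => 2 * (C * ρ ^ α)) (𝓝[>] 0) (𝓝 0) := by
    have h1 := (Real.continuousAt_rpow_const 0 α (Or.inr hα.le)).tendsto
    rw [Real.zero_rpow hα.ne'] at h1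
    have := ((h1.mono_left (nhdsWithin_le_nhds (s := Ioi 0))).const_mul C).const_mul 2
    simpa using this
  have hcauchy : Cauchy (map A (𝓝[>] (0 : ℝ))) := by
    rw [Metric.cauchy_iff]
    refine ⟨inferInstance, fun ε hε => ?_⟩
    obtain ⟨ρ, hρε, hρ0, hρρ⟩ := ((hrpow.eventually_lt_const hε).and
      (Ioc_mem_nhdsGT hρ₀)).exists
    refine ⟨A '' Ioc 0 ρ, image_mem_map (Ioc_mem_nhdsGT hρ0), ?_⟩
    rintro _ ⟨τ, hτ, rfl⟩ _ ⟨τ', hτ', rfl⟩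
    have h1 := hall ρ τ hτ.1 hτ.2 hρρ
    have h2 := hall ρ τ' hτ'.1 hτ'.2 hρρ
    rw [← dist_eq_norm] at h1 h2
    linarith [dist_triangle_left (A τ) (A τ') (A ρ)]
  obtain ⟨L, hL⟩ := CompleteSpace.complete hcauchy
  have hL' : Tendsto A (𝓝[>] 0) (𝓝 L) := hL
  refine ⟨L, hL', fun ρ hρ hρρ => ?_⟩
  refine le_of_tendsto (hL'.const_sub (A ρ)).norm ?_
  filter_upwards [Ioc_mem_nhdsGT hρ] with τ hτ
  exact hall ρ τ hτ.1 hτ.2 hρρ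

theorem preciseRep_eq {n : ℕ} {f : RSpace n → RSpace n} {x L : RSpace n}
    (h : Tendsto (fun r : ℝ => ⨍ y in ball x r, f y) (𝓝[>] 0) (𝓝 L)) : preciseRep f x = L := by
  have hex : ∃ c, Tendsto (fun r : ℝ => ⨍ y in ball x r, f y) (𝓝[>] 0) (𝓝 c) := ⟨L, h⟩
  rw [preciseRep, dif_pos hex]
  exact tendsto_nhds_unique hex.choose_spec h

/-- If `sp > n - 1` and the Gagliardo density is integrable on a sphere, the averages converge to
the precise representative at every point of the sphere, with a uniform rate. -/
theorem exists_average_sub_preciseRep_le {n : ℕ} (hn : n ≠ 0) {s p : ℝ} (hs : 0 < s) (hp : 1 < p)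
    (hsp : (n : ℝ) - 1 < s * p) {Ω : Set (RSpace n)} {a : RSpace n} {r R : ℝ} (hr : 0 < r)
    (hrR : r < R) (hR : ball a R ⊆ Ω) :
    ∃ K : ℝ≥0∞, K ≠ ∞ ∧ ∀ g : RSpace n → RSpace n, Measurable g →
      MemLp g (ENNReal.ofReal p) (volume.restrict Ω) →
      ∫⁻ y, gagliardoDensity n s p (volume.restrict Ω) g y ∂(radialMeasure a r) ≠ ∞ →
      ∀ x ∈ sphere a r, ∀ ρ, 0 < ρ → ρ ≤ min r (R - r) →
        ‖(⨍ z in ball x ρ, g z) - preciseRep g x‖ ≤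
          ((K * ∫⁻ y, gagliardoDensity n s p (volume.restrict Ω) g y ∂(radialMeasure a r)) ^
            (1 / p)).toReal / (1 - 2⁻¹ ^ ((s * p - (n - 1)) / p)) *
              ρ ^ ((s * p - (n - 1)) / p) := by
  have hp0 : 0 < p := by linarith
  obtain ⟨c, hc0, hct, hc⟩ := exists_le_radialMeasure_ball hn a hr
  set P := poincareConst n (n + s * p) with hP
  have hPt : P ≠ ∞ := poincareConst_ne_top n (by positivity)
  have h2p : (2 : ℝ≥0∞) ^ (p - 1) ≠ ∞ :=
    ENNReal.rpow_ne_top_of_nonneg (by linarith) (by norm_num)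
  -- The factor 2^{p-1} · 2 · P comes from the two Poincaré estimates, and 2^{n-1} / c from the
  -- lower bound for the cap of radius τ ≥ ρ/2.
  set K : ℝ≥0∞ := 2 ^ (p - 1) * 2 * P * 2 ^ (n - 1) / c with hK
  have hKt : K ≠ ∞ := ENNReal.div_ne_top (by finiteness) hc0
  refine ⟨K, hKt, fun g hg hgL hΓ x hx => ?_⟩
  set Γ := ∫⁻ y, gagliardoDensity n s p (volume.restrict Ω) g y ∂(radialMeasure a r) with hΓdef
  set α := (s * p - (n - 1)) / p with hα
  have hα0 : 0 < α := div_pos (by linarith) hp0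
  have hρ₀ : 0 < min r (R - r) := lt_min hr (by linarith)
  -- The bound ρ ≤ R - r keeps the balls inside Ω; ρ ≤ r is for the lower cap bound.
  have hball : ∀ ρ, ρ ≤ min r (R - r) → ball x ρ ⊆ Ω := fun ρ hρ =>
    (ball_subset_ball' (by
      rw [mem_sphere.1 hx]
      linarith [hρ.trans (min_le_right _ _)])).trans hR
  have hosc : ∀ ρ τ, 0 < τ → ρ / 2 ≤ τ → τ ≤ ρ → ρ ≤ min r (R - r) →
      ‖(⨍ z in ball x ρ, g z) - ⨍ z in ball x τ, g z‖ ≤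
        ((K * Γ) ^ (1 / p)).toReal * ρ ^ α := by
    intro ρ τ hτ h1 h2 h3
    have hρ : 0 < ρ := hτ.trans_le h2
    set t := ENNReal.ofReal ρ with ht
    have ht0 : t ≠ 0 := (ENNReal.ofReal_pos.2 hρ).ne'
    have htt : t ≠ ∞ := ENNReal.ofReal_ne_top
    set D := ‖(⨍ z in ball x ρ, g z) - ⨍ z in ball x τ, g z‖ₑ ^ p with hD
    have hcap : c * (t ^ (n - 1) * (2 ^ (n - 1))⁻¹) ≤ radialMeasure a r (ball x τ) := by
      refine le_trans ?_ (hc x hx τ hτ (h2.trans (h3.trans (min_le_left _ _))))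
      refine mul_le_mul_right ?_ _
      rw [ENNReal.inv_pow, ← mul_pow]
      refine pow_le_pow_left₀ zero_le ?_ _
      have e : t * 2⁻¹ = ENNReal.ofReal (ρ * 2⁻¹) := by
        rw [ENNReal.ofReal_mul hρ.le, ENNReal.ofReal_inv_of_pos (by norm_num),
          ENNReal.ofReal_ofNat]
      rw [e]
      exact ENNReal.ofReal_le_ofReal (by linarith)
    -- Both averages are compared with g(y) for y in the cap of radius τ, and the Poincaré bounds
    -- are integrated over y. The cap has measure at least of order ρ^{n-1}, leaving ρ^{sp-(n-1)}
    -- after division, with no exceptional x.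
    have hint : D * radialMeasure a r (ball x τ) ≤ 2 ^ (p - 1) * 2 * P * t ^ (s * p) * Γ := by
      rw [← setLIntegral_const]
      have hc' : 2 ^ (p - 1) * 2 * P * t ^ (s * p) ≠ ∞ := by finiteness
      rw [hΓdef, ← lintegral_const_mul' _ _ hc']
      refine le_trans (setLIntegral_mono' measurableSet_ball fun y hy => ?_)
        (setLIntegral_le_lintegral _ _)
      have hA := enorm_average_ball_sub_rpow_le hs.le hp.le hgL hρ (hball ρ h3)
        (ball_subset_ball h2 hy)
      have hB := enorm_average_ball_sub_rpow_le hs.le hp.le hgL hτ (hball τ (h2.trans h3)) hy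
      have hB' := hB.trans (mul_le_mul_left (mul_le_mul_right (ENNReal.rpow_le_rpow
        (ENNReal.ofReal_le_ofReal h2) (by positivity)) _) _)
      calc D ≤ 2 ^ (p - 1) * (‖(⨍ z in ball x ρ, g z) - g y‖ₑ ^ p +
            ‖(⨍ z in ball x τ, g z) - g y‖ₑ ^ p) := by
            refine le_trans (ENNReal.rpow_le_rpow ?_ hp0.le)
              (ENNReal.rpow_add_le_mul_rpow_add_rpow _ _ hp.le)
            rw [← sub_sub_sub_cancel_right _ _ (g y)]
            exact enorm_sub_le
        _ ≤ 2 ^ (p - 1) * (P * t ^ (s * p) * gagliardoDensity n s p (volume.restrict Ω) g y +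
            P * t ^ (s * p) * gagliardoDensity n s p (volume.restrict Ω) g y) :=
            mul_le_mul_right (add_le_add hA hB') _
        _ = _ := by ring
    have hD2 : D ≤ K * Γ * t ^ (α * p) := by
      have hcap' := (mul_le_mul_right hcap D).trans hint
      have hne : c * (t ^ (n - 1) * (2 ^ (n - 1))⁻¹) ≠ 0 :=
        mul_ne_zero hc0 (mul_ne_zero (pow_ne_zero _ ht0) (ENNReal.inv_ne_zero.2 (by finiteness)))
      have hnt : c * (t ^ (n - 1) * (2 ^ (n - 1))⁻¹) ≠ ∞ :=
        ENNReal.mul_ne_top hct (ENNReal.mul_ne_top (by finiteness)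
          (ENNReal.inv_ne_top.2 (by positivity)))
      refine (ENNReal.mul_le_mul_iff_left hne hnt).1 (hcap'.trans (le_of_eq ?_))
      have e1 : t ^ (s * p) = t ^ (α * p) * t ^ (n - 1) := by
        rw [← ENNReal.rpow_natCast, ← ENNReal.rpow_add _ _ ht0 htt, hα, div_mul_cancel₀ _ hp0.ne',
          Nat.cast_sub (Nat.one_le_iff_ne_zero.2 hn), Nat.cast_one]
        congr 1
        ring
      have e2 : (2 : ℝ≥0∞) ^ (n - 1) * (2 ^ (n - 1))⁻¹ = 1 :=
        ENNReal.mul_inv_cancel (by positivity) (by finiteness)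
      have e3 : c⁻¹ * c = 1 := ENNReal.inv_mul_cancel hc0 hct
      rw [hK, e1, div_eq_mul_inv]
      calc _ = 2 ^ (p - 1) * 2 * P * (t ^ (α * p) * t ^ (n - 1)) * Γ * 1 * 1 := by ring
        _ = 2 ^ (p - 1) * 2 * P * (t ^ (α * p) * t ^ (n - 1)) * Γ *
            (2 ^ (n - 1) * (2 ^ (n - 1))⁻¹) * (c⁻¹ * c) := by rw [e2, e3]
        _ = _ := by ring
    have hD3 := ENNReal.rpow_le_rpow hD2 (by positivity : 0 ≤ 1 / p)
    rw [hD, one_div, ENNReal.rpow_rpow_inv hp0.ne', ENNReal.mul_rpow_of_nonneg _ _ (by positivity),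
      ← ENNReal.rpow_mul, mul_assoc, mul_inv_cancel₀ hp0.ne', mul_one] at hD3
    have hfin : (K * Γ) ^ p⁻¹ * t ^ α ≠ ∞ := ENNReal.mul_ne_top
      (ENNReal.rpow_ne_top_of_nonneg (by positivity) (ENNReal.mul_ne_top hKt hΓ))
      (ENNReal.rpow_ne_top_of_nonneg hα0.le htt)
    have hD4 := ENNReal.toReal_mono hfin hD3
    rw [toReal_enorm, ENNReal.toReal_mul, ← ENNReal.toReal_rpow t, ht,
      ENNReal.toReal_ofReal hρ.le] at hD4
    rwa [one_div]
  obtain ⟨L, hL, hrate⟩ := exists_tendsto_of_dyadic_le ENNReal.toReal_nonneg hα0 hρ₀ hosc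
  intro ρ hρ hρρ
  rw [preciseRep_eq hL]
  exact hrate ρ hρ hρρ

/-! ### Locality of averages and of the precise representative -/

theorem ball_infDist_frontier_subset {E : Type*} [NormedAddCommGroup E] [NormedSpace ℝ E]
    {Ω : Set E} (hΩ : IsOpen Ω) {x : E} (hx : x ∈ Ω) : ball x (infDist x (frontier Ω)) ⊆ Ω := by
  rcases le_or_gt (infDist x (frontier Ω)) 0 with h0 | h0
  · rw [ball_eq_empty.2 h0]
    exact empty_subset _
  -- The ball is connected, meets Ω, and misses the frontier, so it cannot reach the exterior.
  refine (convex_ball x _).isPreconnected.subset_left_of_subset_union hΩ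
    (isClosed_closure (s := Ω)).isOpen_compl
    (disjoint_compl_right.mono_left subset_closure) ?_ ⟨x, mem_ball_self h0, hx⟩
  intro y hy
  by_cases hyΩ : y ∈ Ω
  · exact Or.inl hyΩ
  refine Or.inr fun hyc => ?_
  have hyf : y ∈ frontier Ω := by
    rw [hΩ.frontier_eq]
    exact ⟨hyc, hyΩ⟩
  have := infDist_le_dist_of_mem (x := x) hyf
  rw [mem_ball, dist_comm] at hy
  linarith

section Congr

variable {n : ℕ} {Ω : Set (RSpace n)} {f g : RSpace n → RSpace n}

theorem average_ball_congr (h : f =ᵐ[volume.restrict Ω] g) {x : RSpace n} {ρ : ℝ}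
    (hx : ball x ρ ⊆ Ω) : ⨍ y in ball x ρ, f y = ⨍ y in ball x ρ, g y :=
  average_congr (ae_restrict_of_ae_restrict_of_subset hx h)

/-- Averages over small balls inside Ω depend only on the class of the function, so equality holds
at every point. This permits passing to measurable modifications even for the uniform statement. -/
theorem preciseRep_congr (hΩ : IsOpen Ω) (h : f =ᵐ[volume.restrict Ω] g) {x : RSpace n}
    (hx : x ∈ Ω) : preciseRep f x = preciseRep g x := by
  obtain ⟨ε, hε, hεΩ⟩ := Metric.isOpen_iff.1 hΩ x hx
  have hev : (fun r : ℝ => ⨍ y in ball x r, f y) =ᶠ[𝓝[>] 0] fun r => ⨍ y in ball x r, g y := by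
    filter_upwards [Ioo_mem_nhdsGT hε] with r hr
    exact average_ball_congr h ((ball_subset_ball hr.2.le).trans hεΩ)
  by_cases hc : ∃ c, Tendsto (fun r : ℝ => ⨍ y in ball x r, f y) (𝓝[>] 0) (𝓝 c)
  · obtain ⟨c, hc⟩ := hc
    rw [preciseRep_eq hc, preciseRep_eq (hc.congr' hev)]
  · have hc' : ¬ ∃ c, Tendsto (fun r : ℝ => ⨍ y in ball x r, g y) (𝓝[>] 0) (𝓝 c) :=
      fun ⟨c, h'⟩ => hc ⟨c, h'.congr' hev.symm⟩
    rw [preciseRep, preciseRep, dif_neg hc, dif_neg hc']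

/-- The Lebesgue differentiation theorem for the precise representative. -/
theorem preciseRep_ae_eq (hΩ : IsOpen Ω) {p : ℝ} (hp : 1 ≤ p)
    (hf : MemLp f (ENNReal.ofReal p) (volume.restrict Ω)) :
    preciseRep f =ᵐ[volume.restrict Ω] f := by
  rcases n.eq_zero_or_pos with rfl | hn
  · exact ae_of_all _ fun x => Subsingleton.elim _ _
  have : Nonempty (Fin n) := ⟨⟨0, hn⟩⟩
  -- Extension by zero gives a locally integrable function on the whole space, for which Lebesgue
  -- differentiation is available; near points of the open set Ω nothing changes.
  have hF : MemLp (Ω.indicator f) (ENNReal.ofReal p) volume :=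
    (memLp_indicator_iff_restrict hΩ.measurableSet).2 hf
  have hloc := hF.locallyIntegrable (by simpa using hp)
  have hae := IsUnifLocDoublingMeasure.ae_tendsto_average volume hloc 1
  filter_upwards [ae_restrict_of_ae hae, ae_restrict_mem hΩ.measurableSet] with x hx hxΩ
  have h1 := hx (l := 𝓝[>] (0 : ℝ)) (fun _ => x) id tendsto_id (by
    filter_upwards [self_mem_nhdsWithin] with r hr
    exact mem_closedBall_self (by simpa using le_of_lt hr))
  have h2 : Tendsto (fun r : ℝ => ⨍ y in ball x r, Ω.indicator f y) (𝓝[>] 0)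
      (𝓝 (Ω.indicator f x)) := by
    refine h1.congr fun r => setAverage_congr ?_
    exact (ae_eq_of_subset_of_measure_ge ball_subset_closedBall
      (Measure.addHaar_closedBall_eq_addHaar_ball volume x r).le
      measurableSet_ball.nullMeasurableSet measure_closedBall_lt_top.ne).symm
  rw [preciseRep_congr hΩ (g := Ω.indicator f) ?_ hxΩ, preciseRep_eq h2, indicator_of_mem hxΩ]
  filter_upwards [ae_restrict_mem hΩ.measurableSet] with y hy
  rw [indicator_of_mem hy]

theorem gagliardoPow_congr {d s p : ℝ} {μ : Measure (RSpace n)} (h : f =ᵐ[μ] g) :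
    gagliardoPow d s p μ f = gagliardoPow d s p μ g := by
  refine lintegral_congr_ae ?_
  filter_upwards [h] with x hx
  refine lintegral_congr_ae ?_
  filter_upwards [h] with y hy
  rw [hx, hy]

theorem lintegral_enorm_rpow_congr {p : ℝ} {μ : Measure (RSpace n)} (h : f =ᵐ[μ] g) :
    ∫⁻ x, ‖f x‖ₑ ^ p ∂μ = ∫⁻ x, ‖g x‖ₑ ^ p ∂μ := by
  refine lintegral_congr_ae ?_
  filter_upwards [h] with x hx
  rw [hx]

end Congr

/-- Averages over balls are continuous for the weak convergence. -/
theorem WeaklyConverges.tendsto_average {n : ℕ} {d s p : ℝ} {hp : 1 ≤ p} {Ω : Set (RSpace n)}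
    {f : ℕ → RSpace n → RSpace n} {f₀ : RSpace n → RSpace n}
    (h : WeaklyConverges d s p hp (volume.restrict Ω) f f₀) {x : RSpace n} {ρ : ℝ} (hρ : 0 < ρ)
    (hx : ball x ρ ⊆ Ω) :
    Tendsto (fun k => ⨍ z in ball x ρ, f k z) atTop (𝓝 (⨍ z in ball x ρ, f₀ z)) := by
  have hp0 : 0 < p := by linarith
  obtain ⟨hf, hf₀, H⟩ := h
  rw [(EuclideanSpace.equiv (Fin n) ℝ).toHomeomorph.isInducing.tendsto_nhds_iff,
    tendsto_pi_nhds]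
  intro i
  let L : fracSobolev d s p hp (volume.restrict Ω) →ₗ[ℝ] ℝ :=
    { toFun := fun w => (⨍ z in ball x ρ, w.1 z) i
      map_add' := fun u v => by
        have hu := integrableOn_ball_of_memLp hp u.2.1 hx
        have hv := integrableOn_ball_of_memLp hp v.2.1 hx
        simp only [setAverage_eq, Submodule.coe_add, Pi.add_apply]
        rw [integral_add hu hv, smul_add, PiLp.add_apply]
      map_smul' := fun c u => by
        simp only [setAverage_eq, Submodule.coe_smul, Pi.smul_apply, RingHom.id_apply]
        rw [integral_smul, smul_comm, PiLp.smul_apply] }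
  have hV0 : (volume (ball x ρ)) ≠ 0 := (measure_ball_pos _ _ hρ).ne'
  have hVt : (volume (ball x ρ)) ≠ ∞ := measure_ball_lt_top.ne
  have hVi : ((volume (ball x ρ))⁻¹) ^ (1 / p) ≠ ∞ :=
    ENNReal.rpow_ne_top_of_nonneg (by positivity) (ENNReal.inv_ne_top.2 hV0)
  refine H L ⟨(((volume (ball x ρ))⁻¹) ^ (1 / p)).toReal, fun w => ?_⟩
  have h1 := enorm_average_sub_rpow_le hp hV0 hVt (integrableOn_ball_of_memLp hp w.2.1 hx) 0
  simp only [sub_zero] at h1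
  have hfin : (∫⁻ x in Ω, ‖w.1 x‖ₑ ^ p) + gagliardoPow d s p (volume.restrict Ω) w.1 ≠ ∞ :=
    (ENNReal.add_lt_top.2 ⟨(memLp_ofReal_iff hp w.2.1.1).1 w.2.1, w.2.2⟩).ne
  have h2 := h1.trans (mul_le_mul_right ((lintegral_mono_set hx).trans (le_self_add
    (b := gagliardoPow d s p (volume.restrict Ω) w.1))) _)
  have h3 := ENNReal.rpow_le_rpow h2 (by positivity : 0 ≤ 1 / p)
  rw [ENNReal.mul_rpow_of_nonneg _ _ (by positivity)] at h3
  have h4 : (‖⨍ z in ball x ρ, w.1 z‖ₑ ^ p) ^ (1 / p) = ‖⨍ z in ball x ρ, w.1 z‖ₑ := by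
    rw [one_div, ENNReal.rpow_rpow_inv hp0.ne']
  rw [h4] at h3
  have h5 := ENNReal.toReal_mono (ENNReal.mul_ne_top hVi
    (ENNReal.rpow_ne_top_of_nonneg (by positivity) hfin)) h3
  rw [toReal_enorm, ENNReal.toReal_mul] at h5
  exact (PiLp.norm_apply_le (⨍ z in ball x ρ, w.1 z) i).trans h5

/-! ### Restriction to almost every sphere -/

section Restriction

variable {n : ℕ} {s p : ℝ} {Ω : Set (RSpace n)} {g : ℕ → RSpace n → RSpace n}
  {g₀ : RSpace n → RSpace n}

/-- On a sphere where the averages of a sequence converge to the precise representatives with a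
uniform rate, convergence in `L^p` of a neighbourhood gives uniform convergence. -/
theorem tendstoUniformlyOn_preciseRep (hn : n ≠ 0) (hs : 0 < s) (hp : 1 < p)
    (hsp : (n : ℝ) - 1 < s * p) {a : RSpace n} {r R : ℝ} (hr : 0 < r) (hrR : r < R)
    (hR : ball a R ⊆ Ω) (hg : ∀ k, Measurable (g k)) (hg₀ : Measurable g₀)
    (hgL : ∀ k, MemLp (g k) (ENNReal.ofReal p) (volume.restrict Ω))
    (hg₀L : MemLp g₀ (ENNReal.ofReal p) (volume.restrict Ω)) {B : ℝ≥0∞} (hB : B ≠ ∞)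
    (hgB : ∀ k, ∫⁻ y, gagliardoDensity n s p (volume.restrict Ω) (g k) y ∂(radialMeasure a r) ≤ B)
    (hg₀B : ∫⁻ y, gagliardoDensity n s p (volume.restrict Ω) g₀ y ∂(radialMeasure a r) ≤ B)
    (hlim : Tendsto (fun k => ∫⁻ x in ball a R, ‖g k x - g₀ x‖ₑ ^ p) atTop (𝓝 0)) :
    TendstoUniformlyOn (fun k => preciseRep (g k)) (preciseRep g₀) atTop (sphere a r) := by
  have hp0 : 0 < p := by linarith
  obtain ⟨K, hK, H⟩ := exists_average_sub_preciseRep_le hn hs hp hsp hr hrR hR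
  set α := (s * p - (n - 1)) / p with hα
  have hα0 : 0 < α := div_pos (by linarith) hp0
  have hq1 : (2⁻¹ : ℝ) ^ α < 1 := Real.rpow_lt_one (by norm_num) (by norm_num) hα0
  set T := ((K * B) ^ (1 / p)).toReal / (1 - 2⁻¹ ^ α) with hT
  have hrate : ∀ u : RSpace n → RSpace n, Measurable u →
      MemLp u (ENNReal.ofReal p) (volume.restrict Ω) →
      ∫⁻ y, gagliardoDensity n s p (volume.restrict Ω) u y ∂(radialMeasure a r) ≤ B →
      ∀ x ∈ sphere a r, ∀ ρ, 0 < ρ → ρ ≤ min r (R - r) →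
        ‖(⨍ z in ball x ρ, u z) - preciseRep u x‖ ≤ T * ρ ^ α := by
    intro u hu huL huB x hx ρ hρ hρρ
    refine (H u hu huL (ne_top_of_le_ne_top hB huB) x hx ρ hρ hρρ).trans ?_
    have h1 : ((K * ∫⁻ y, gagliardoDensity n s p (volume.restrict Ω) u y
        ∂(radialMeasure a r)) ^ (1 / p)).toReal ≤ ((K * B) ^ (1 / p)).toReal :=
      ENNReal.toReal_mono
        (ENNReal.rpow_ne_top_of_nonneg (by positivity) (ENNReal.mul_ne_top hK hB))
        (ENNReal.rpow_le_rpow (mul_le_mul_right huB _) (by positivity))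
    have h2 : 0 ≤ 1 - (2⁻¹ : ℝ) ^ α := by linarith
    rw [hT]
    gcongr
  have hrpow : Tendsto (fun ρ : ℝ => T * ρ ^ α) (𝓝[>] 0) (𝓝 0) := by
    have h1 := (Real.continuousAt_rpow_const 0 α (Or.inr hα0.le)).tendsto
    rw [Real.zero_rpow hα0.ne'] at h1
    have := (h1.mono_left (nhdsWithin_le_nhds (s := Ioi 0))).const_mul T
    simpa using this
  rw [Metric.tendstoUniformlyOn_iff]
  intro ε hε
  -- The scale is chosen before k and x, as the rate is uniform in both. The middle term of the
  -- three-term estimate is then bounded by |B(0, ρ)|^{-1} times the L^p error, uniformly in x.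
  obtain ⟨ρ, hρε, hρ, hρρ⟩ := ((hrpow.eventually_lt_const (by positivity : 0 < ε / 3)).and
    (Ioc_mem_nhdsGT (lt_min hr (sub_pos.2 hrR)))).exists
  set V := volume (ball (0 : RSpace n) ρ) with hV
  have hV0 : V ≠ 0 := (measure_ball_pos _ _ hρ).ne'
  have hVt : V ≠ ∞ := measure_ball_lt_top.ne
  have hVx : ∀ x : RSpace n, volume (ball x ρ) = V := fun x => Measure.addHaar_ball_center _ _ _
  have h3 := ENNReal.Tendsto.const_mul (a := V⁻¹) hlim (Or.inr (ENNReal.inv_ne_top.2 hV0))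
  rw [mul_zero] at h3
  have hε3 : 0 < ENNReal.ofReal (ε / 3) ^ p :=
    ENNReal.rpow_pos (ENNReal.ofReal_pos.2 (by positivity)) ENNReal.ofReal_ne_top
  filter_upwards [h3.eventually_lt_const hε3] with k hk x hx
  have hbR : ball x ρ ⊆ ball a R := ball_subset_ball' (by
    rw [mem_sphere.1 hx]
    linarith [hρρ.trans (min_le_right _ _)])
  have hi1 := integrableOn_ball_of_memLp hp.le (hgL k) (hbR.trans hR)
  have hi2 := integrableOn_ball_of_memLp hp.le hg₀L (hbR.trans hR)
  have h4 : ‖(⨍ z in ball x ρ, g k z) - ⨍ z in ball x ρ, g₀ z‖ < ε / 3 := by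
    have h5 := enorm_average_sub_rpow_le hp.le (by rwa [hVx]) (by rwa [hVx]) (hi1.sub hi2) 0
    have h6 : ⨍ z in ball x ρ, (g k - g₀) z =
        (⨍ z in ball x ρ, g k z) - ⨍ z in ball x ρ, g₀ z := by
      simp only [setAverage_eq, Pi.sub_apply]
      rw [integral_sub hi1 hi2, smul_sub]
    rw [h6, hVx] at h5
    simp only [sub_zero, Pi.sub_apply] at h5
    have h7 := (h5.trans (mul_le_mul_right (lintegral_mono_set hbR) _)).trans_lt hk
    have h8 := (ENNReal.rpow_lt_rpow_iff hp0).1 h7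
    rw [← ofReal_norm] at h8
    exact (ENNReal.ofReal_lt_ofReal_iff (by positivity)).1 h8
  have h9 := hrate (g k) (hg k) (hgL k) (hgB k) x hx ρ hρ hρρ
  have h10 := hrate g₀ hg₀ hg₀L hg₀B x hx ρ hρ hρρ
  rw [dist_eq_norm]
  have e1 : preciseRep g₀ x - preciseRep (g k) x =
      -((⨍ z in ball x ρ, g₀ z) - preciseRep g₀ x) +
        (-((⨍ z in ball x ρ, g k z) - ⨍ z in ball x ρ, g₀ z) +
          ((⨍ z in ball x ρ, g k z) - preciseRep (g k) x)) := by abel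
  rw [e1]
  have e2 := norm_add_le (-((⨍ z in ball x ρ, g₀ z) - preciseRep g₀ x))
    (-((⨍ z in ball x ρ, g k z) - ⨍ z in ball x ρ, g₀ z) +
      ((⨍ z in ball x ρ, g k z) - preciseRep (g k) x))
  have e3 := norm_add_le (-((⨍ z in ball x ρ, g k z) - ⨍ z in ball x ρ, g₀ z))
    ((⨍ z in ball x ρ, g k z) - preciseRep (g k) x)
  rw [norm_neg] at e2 e3
  linarith

/-- Restriction of a weakly convergent sequence to almost every sphere of a smaller ball. -/
theorem ae_exists_subseq_sphere (hn : n ≠ 0) (hs : 0 < s) (hp : 1 < p) (hΩ : IsOpen Ω)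
    {f : ℕ → RSpace n → RSpace n} {f₀ : RSpace n → RSpace n}
    (hf : WeaklyConverges (n : ℝ) s p hp.le (volume.restrict Ω) f f₀) {a : RSpace n} {R R' : ℝ}
    (hR : ball a R ⊆ Ω) (hRR : R' < R) :
    ∀ᵐ r ∂(volume.restrict (Ioo (0 : ℝ) R')), ∃ φ : ℕ → ℕ, StrictMono φ ∧
      WeaklyConverges ((n : ℝ) - 1) s p hp.le (sphereMeasure a r)
        (fun k => preciseRep (f (φ k))) (preciseRep f₀) ∧
      ((n : ℝ) - 1 < s * p → TendstoUniformlyOn (fun k => preciseRep (f (φ k))) (preciseRep f₀)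
        atTop (sphere a r)) := by
  have hp0 : 0 < p := by linarith
  have hR'Ω : ball a R' ⊆ Ω := (ball_subset_ball hRR.le).trans hR
  obtain ⟨M, hM, hfM⟩ := hf.exists_bound
  have hmem := hf.choose
  have hmem₀ := hf.choose_spec.choose
  set g : ℕ → RSpace n → RSpace n := fun k => (hmem k).1.1.mk (f k) with hgdef
  set g₀ : RSpace n → RSpace n := hmem₀.1.1.mk f₀ with hg₀def
  have hg : ∀ k, Measurable (g k) := fun k => (hmem k).1.1.stronglyMeasurable_mk.measurable
  have hg₀ : Measurable g₀ := hmem₀.1.1.stronglyMeasurable_mk.measurable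
  have hfg : ∀ k, f k =ᵐ[volume.restrict Ω] g k := fun k => (hmem k).1.1.ae_eq_mk
  have hfg₀ : f₀ =ᵐ[volume.restrict Ω] g₀ := hmem₀.1.1.ae_eq_mk
  have hgL : ∀ k, MemLp (g k) (ENNReal.ofReal p) (volume.restrict Ω) :=
    fun k => (hmem k).1.ae_eq (hfg k)
  have hg₀L : MemLp g₀ (ENNReal.ofReal p) (volume.restrict Ω) := hmem₀.1.ae_eq hfg₀
  have henergy : ∀ u v : RSpace n → RSpace n, Measurable v → u =ᵐ[volume.restrict Ω] v →
      ∫⁻ x in Ω, ‖v x‖ₑ ^ p + gagliardoDensity n s p (volume.restrict Ω) v x =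
        (∫⁻ x in Ω, ‖u x‖ₑ ^ p) + gagliardoPow n s p (volume.restrict Ω) u := by
    intro u v hv huv
    rw [lintegral_add_left (hv.enorm.pow_const p), lintegral_enorm_rpow_congr huv,
      gagliardoPow_congr huv]
    rfl
  set M₀ := (∫⁻ x in Ω, ‖f₀ x‖ₑ ^ p) + gagliardoPow n s p (volume.restrict Ω) f₀ with hM₀
  have hM₀t : M₀ ≠ ∞ :=
    (ENNReal.add_lt_top.2 ⟨(memLp_ofReal_iff hp.le hmem₀.1.1).1 hmem₀.1, hmem₀.2⟩).ne
  have hgM : ∀ k, ∫⁻ x in Ω, ‖g k x‖ₑ ^ p +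
      gagliardoDensity n s p (volume.restrict Ω) (g k) x ≤ M + M₀ := fun k => by
    rw [henergy (f k) (g k) (hg k) (hfg k)]
    exact (hfM k).trans le_self_add
  have hg₀M : ∫⁻ x in Ω, ‖g₀ x‖ₑ ^ p + gagliardoDensity n s p (volume.restrict Ω) g₀ x = M₀ :=
    henergy f₀ g₀ hg₀ hfg₀
  have hlim : Tendsto (fun k => ∫⁻ x in ball a R', ‖g k x - g₀ x‖ₑ ^ p) atTop (𝓝 0) := by
    refine tendsto_lintegral_sub_of_average hs hp hg hg₀ hgL hg₀L
      (ENNReal.add_ne_top.2 ⟨hM, hM₀t⟩) hgM ?_ ?_ hR hRR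
    · exact ((lintegral_mono fun x => le_add_self).trans hg₀M.le).trans le_add_self
    · intro x ρ hρ hx
      simp_rw [← average_ball_congr (hfg _) hx, ← average_ball_congr hfg₀ hx]
      exact hf.tendsto_average hρ hx
  -- This first subsequence does not depend on r; only the extraction from the finite liminf below
  -- does.
  obtain ⟨ψ, hψ, hψae⟩ : ∃ ψ : ℕ → ℕ, StrictMono ψ ∧ ∀ᵐ x ∂(volume.restrict (ball a R')),
      Tendsto (fun k => g (ψ k) x) atTop (𝓝 (g₀ x)) := by
    refine (tendstoInMeasure_of_tendsto_eLpNorm (p := ENNReal.ofReal p)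
      (ENNReal.ofReal_pos.2 hp0).ne' (fun k => (hg k).aestronglyMeasurable)
      hg₀.aestronglyMeasurable ?_).exists_seq_tendsto_ae
    have h1 := hlim.ennrpow_const (1 / p)
    rw [ENNReal.zero_rpow_of_pos (by positivity)] at h1
    refine h1.congr fun k => ?_
    rw [eLpNorm_eq_lintegral_ofReal hp.le]
    rfl
  set e : (RSpace n → RSpace n) → RSpace n → ℝ≥0∞ := fun u x =>
    ‖u x‖ₑ ^ p + gagliardoDensity n s p (volume.restrict Ω) u x with he
  have hem : ∀ u : RSpace n → RSpace n, Measurable u → Measurable (e u) := fun u hu =>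
    (hu.enorm.pow_const p).add (measurable_gagliardoDensity n s p _ hu)
  -- Adding the energy of the limit to every term makes a single liminf control both the sequence
  -- and g₀ on the sphere.
  have hliminf := ae_liminf_radialMeasure hn a (R := R')
    (F := fun k x => e (g (ψ k)) x + e g₀ x) (fun k => (hem _ (hg _)).add (hem _ hg₀))
    (M := (M + M₀) + M₀) (by finiteness) fun k => by
      rw [lintegral_add_left (hem _ (hg _))]
      exact add_le_add ((lintegral_mono_set hR'Ω).trans (hgM _))
        ((lintegral_mono_set hR'Ω).trans hg₀M.le)
  have hrep : ∀ k, ∀ᵐ x ∂(volume.restrict Ω), preciseRep (f k) x = g k x := fun k =>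
    (preciseRep_ae_eq hΩ hp.le (hmem k).1).trans (hfg k)
  have hrep₀ : ∀ᵐ x ∂(volume.restrict Ω), preciseRep f₀ x = g₀ x :=
    (preciseRep_ae_eq hΩ hp.le hmem₀.1).trans hfg₀
  filter_upwards [hliminf, ae_all_iff.2 fun k => ae_radialMeasure hn a hR'Ω (hrep k),
    ae_radialMeasure hn a hR'Ω hrep₀, ae_radialMeasure hn a subset_rfl hψae,
    ae_restrict_mem measurableSet_Ioo] with r hr1 hr2 hr3 hr4 hr
  obtain ⟨B, hB1, hBt⟩ := exists_between hr1
  obtain ⟨φ', hφ', hφB⟩ := extraction_of_frequently_atTop (frequently_lt_of_liminf_lt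
    (by isBoundedDefault) hB1)
  have hrΩ : ball a r ⊆ Ω := (ball_subset_ball hr.2.le).trans hR'Ω
  have hsΩ : sphere a r ⊆ Ω := (sphere_subset_ball hr.2).trans hR'Ω
  have hBk : ∀ k, ∫⁻ x, e (g (ψ (φ' k))) x ∂(radialMeasure a r) ≤ B := fun k =>
    (lintegral_mono fun x => le_self_add).trans (hφB k).le
  have hB₀ : ∫⁻ x, e g₀ x ∂(radialMeasure a r) ≤ B :=
    (lintegral_mono fun x => le_add_self).trans (hφB 0).le
  refine ⟨ψ ∘ φ', hψ.comp hφ', ?_, fun hsp => ?_⟩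
  · have := isFiniteMeasure_sphereMeasure hn a r
    obtain ⟨C, hC, hνC⟩ := exists_sphereMeasure_le_smul hn a hr.1
    have hac : sphereMeasure a r ≪ radialMeasure a r :=
      (Measure.absolutelyContinuous_of_le hνC).trans Measure.smul_absolutelyContinuous
    obtain ⟨C', hC', hνC'⟩ := exists_sphereMeasure_ball_le hn a hr.1
    obtain ⟨K, hK, hKu⟩ := exists_gagliardoPow_sphere_le hn hs hp a hr.1 (sphereMeasure a r)
      (ae_restrict_mem isClosed_sphere.measurableSet) hC' hνC' hrΩ
    have hint : ∀ F : RSpace n → ℝ≥0∞, ∫⁻ x, F x ∂(sphereMeasure a r) ≤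
        C * ∫⁻ x, F x ∂(radialMeasure a r) := fun F => by
      rw [← smul_eq_mul, ← lintegral_smul_measure]
      exact lintegral_mono' hνC le_rfl
    have hbound : ∀ u v : RSpace n → RSpace n, Measurable v →
        (∀ᵐ x ∂(radialMeasure a r), u x = v x) → ∫⁻ x, e v x ∂(radialMeasure a r) ≤ B →
        ∫⁻ x, ‖u x‖ₑ ^ p ∂(sphereMeasure a r) +
          gagliardoPow ((n : ℝ) - 1) s p (sphereMeasure a r) u ≤ C * B + K * (C * B) := by
      intro u v hv huv hvB
      have huv' : u =ᵐ[sphereMeasure a r] v := hac.ae_le huv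
      rw [lintegral_enorm_rpow_congr huv', gagliardoPow_congr huv']
      refine add_le_add ((hint _).trans (mul_le_mul_right (le_trans ?_ hvB) _))
        ((hKu v hv).trans (mul_le_mul_right ((hint _).trans
          (mul_le_mul_right (le_trans ?_ hvB) _)) _))
      · exact lintegral_mono fun x => le_self_add
      · exact lintegral_mono fun x => le_add_self
    have hfin : C * B + K * (C * B) ≠ ∞ := by finiteness
    have hb₀ := hbound (preciseRep f₀) g₀ hg₀ hr3 hB₀
    have hms₀ : AEStronglyMeasurable (preciseRep f₀) (sphereMeasure a r) :=
      hg₀.aestronglyMeasurable.congr (EventuallyEq.symm (hac.ae_le hr3))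
    -- All almost everywhere statements were obtained for the cone measure; absolute continuity
    -- carries them to ℋ^{n-1}.
    refine weaklyConverges_of_ae_tendsto _ s hp (fun k => ?_) ⟨?_, ?_⟩ hfin (fun k =>
      hbound _ (g (ψ (φ' k))) (hg _) (hr2 _) (hBk k)) ?_
    · exact (hg (ψ (φ' k))).aestronglyMeasurable.congr (EventuallyEq.symm (hac.ae_le (hr2 _)))
    · exact (memLp_ofReal_iff hp.le hms₀).2 ((le_self_add.trans hb₀).trans_lt hfin.lt_top)
    · exact (le_add_self.trans hb₀).trans_lt hfin.lt_top
    · filter_upwards [hac.ae_le hr4, hac.ae_le hr3, ae_all_iff.2 fun k => hac.ae_le (hr2 k)]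
        with x hx hx3 hx2
      rw [hx3]
      simp only [Function.comp_apply, hx2]
      exact hx.comp hφ'.tendsto_atTop
  · have hunif := tendstoUniformlyOn_preciseRep hn hs hp hsp hr.1 hr.2 hR'Ω
      (fun k => hg (ψ (φ' k))) hg₀ (fun k => hgL (ψ (φ' k))) hg₀L hBt.ne
      (fun k => (lintegral_mono fun x => le_add_self).trans (hBk k))
      ((lintegral_mono fun x => le_add_self).trans hB₀)
      (hlim.comp (hψ.comp hφ').tendsto_atTop)
    refine (hunif.congr (Eventually.of_forall fun k x hx => ?_)).congr_right fun x hx => ?_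
    · exact (preciseRep_congr hΩ (hfg _) (hsΩ hx)).symm
    · exact (preciseRep_congr hΩ hfg₀ (hsΩ hx)).symm

end Restriction

end

theorem lemma4p1 (n : ℕ) (hn : 2 ≤ n) (s p : ℝ) (hs0 : 0 < s) (hs1 : s < 1) (hp : 1 < p)
    (Ω : Set (RSpace n)) (hΩo : IsOpen Ω) (hΩc : IsConnected Ω) (hΩb : Bornology.IsBounded Ω)
    (f : ℕ → RSpace n → RSpace n) (f₀ : RSpace n → RSpace n)
    (hf : WeaklyConverges (n : ℝ) s p hp.le (volume.restrict Ω) f f₀)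
    (x₀ : RSpace n) (hx₀ : x₀ ∈ Ω) :
    ∃ N : Set ℝ, volume N = 0 ∧
      ∀ r ∈ Ioo 0 (infDist x₀ (frontier Ω)) \ N,
        ∃ φ : ℕ → ℕ, StrictMono φ ∧
          WeaklyConverges ((n : ℝ) - 1) s p hp.le (sphereMeasure x₀ r)
            (fun k => preciseRep (f (φ k))) (preciseRep f₀) ∧
          ((n : ℝ) - 1 < s * p →
            TendstoUniformlyOn (fun k => preciseRep (f (φ k))) (preciseRep f₀) atTop
              (sphere x₀ r)) := by
  set R := infDist x₀ (frontier Ω) with hR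
  have hball : ball x₀ R ⊆ Ω := ball_infDist_frontier_subset hΩo hx₀
  -- Strong convergence holds only on strictly smaller balls, so (0, R) is exhausted by the
  -- intervals (0, R - 1/(m+1)). N is the set where this countable conjunction fails.
  have hae : ∀ᵐ r : ℝ, ∀ m : ℕ, r ∈ Ioo 0 (R - 1 / ((m : ℝ) + 1)) → _ := ae_all_iff.2 fun m =>
    (ae_restrict_iff' measurableSet_Ioo).1 (ae_exists_subseq_sphere (by omega) hs0 hp hΩo hf hball
      (sub_lt_self R (by positivity)))
  refine ⟨_, hae, fun r hr => ?_⟩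
  have hrN := hr.2
  rw [mem_compl_iff, not_not] at hrN
  obtain ⟨m, hm⟩ := exists_nat_one_div_lt (sub_pos.2 hr.1.2)
  exact hrN m ⟨hr.1.1, by linarith⟩
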